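/- **Setting.** Let $K\ge 1$ and let $\nu_1,\dots,\nu_K$ be probability distributions on $[0,1]$ with means $\mu_1,\dots,\mu_K$; put $\mu^*=\max_a\mu_a$ and $\Delta_a=\mu^*-\mu_a$. In round $t=1,2,\dots$ an arm $a_t$ is played and a reward drawn from $\nu_{a_t}$, independently of the past, is observed. For $\epsilon\in[0,1]$, a function $f:[0,1]\to[0,\infty)$ is an *$\epsilon$-gap function* if $f(\Delta)=0$ for $\Delta\in[0,\epsilon]$ and $f(\Delta)>0$ for $\Delta\in(\epsilon,1]$. The *lenient regret* is $R_f(T)=\mathbb E\big[\sum_{t=1}^T f(\Delta_{a_t})\big]$. Let $d(p,q)=p\ln\frac pq+(1-p)\ln\frac{1-p}{1-q}$, with $d(p,q)=\infty$ if $p<1\le q$ or $p>0=q$. **The algorithm $\epsilon$-TS.** A reward $x\in[0,1]$ is replaced by $1$ with probability $x$ and by $0$ with probability $1-x$ (which changes nothing for rewards in $\{0,1\}$). Before round $t$ let $N_a$ be the number of plays of arm $a$ so far, $S_a$ the sum of its rounded rewards, and $\hat\mu_a=S_a/N_a$ ($\hat\mu_a=0$ if $N_a=0$). Given the past, draw independently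 for every arm $a$ an index $\theta_a$: if $\hat\mu_a>1-\epsilon$, then $\theta_a=\hat\mu_a$; otherwise $\theta_a=(1-\epsilon)Y_a$ with $Y_a\sim\mathrm{Beta}(\alpha_a,\,N_a+2-\alpha_a)$, $\alpha_a=\lfloor S_a/(1-\epsilon)\rfloor+1$ (with $0/0=0$ if $\epsilon=1$). Play an arm that maximizes $\theta_a$, ties being broken uniformly at random. **Theorem.** Let $f$ be an $\epsilon$-gap function, and let $R_f(T)$ be the lenient regret of $\epsilon$-TS. 1. $$\limsup_{T\to\infty}\frac{R_f(T)}{\ln T}\le U:=\sum_{a:\Delta_a>\epsilon}\frac{f(\Delta_a)}{d\big(\frac{\mu_a}{1-\epsilon},\frac{\mu^*}{1-\epsilon}\big)} .$$ 2. There is an absolute constant $C$ such that always $$U\le C\sum_{a:\Delta_a>\epsilon}\frac{f(\Delta_a)}{d(\mu_a,\mu^*+\epsilon)} .$$ Moreover, for Bernoulli arms and any set $\mathcal D$ of probability distributions on $[0,1]$ that contains all Bernoulli distributions, $$U\le C\sum_{a:\Delta_a>\epsilon}\frac{f(\Delta_a)}{\mathcal K_{\inf}(\nu_a,\mu^*+\epsilon,\mathcal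 D)},\qquad \mathcal K_{\inf}(\nu,x,\mathcal D)=\inf\{\mathrm{KL}(\nu,\nu'):\nu'\in\mathcal D,\ \mathbb E[\nu']>x\}\quad(\inf\emptyset=\infty),$$ that is, $U$ matches, up to an absolute constant, the known asymptotic lower bound (the sum on the right) on $R_f(T)/\ln T$ for strategies consistent over $\mathcal D$. 3. If $\mu^*>1-\epsilon$, then $R_f(T)=O(1)$ as $T\to\infty$; more precisely $R_f(T)\le M\max_a f(\Delta_a)$ for all $T$, where $M$ depends only on $\epsilon$ and the means $\mu_1,\dots,\mu_K$. -/

import Mathlib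

open MeasureTheory ProbabilityTheory Filter
open scoped ENNReal NNReal

noncomputable section

namespace LenientBandit

/-- The Bernoulli relative entropy `d(p, q)`, with values in `[0, ∞]`.
It is `∞` if `p < 1 ≤ q`, or if `q = 0 < p`; the convention `0 * log 0 = 0` is built in. -/
def bernKL (p q : ℝ) : ℝ≥0∞ :=
  if (p < 1 ∧ 1 ≤ q) ∨ (0 < p ∧ q = 0) then ∞
  else ENNReal.ofReal (p * Real.log (p / q) + (1 - p) * Real.log ((1 - p) / (1 - q)))

/-- `f` (of which only the restriction to `[0, 1]` matters) is an `ε`-gap function. -/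
structure IsGapFunction (ε : ℝ) (f : ℝ → ℝ) : Prop where
  eps_mem : ε ∈ Set.Icc (0 : ℝ) 1
  eq_zero : ∀ δ ∈ Set.Icc (0 : ℝ) ε, f δ = 0
  pos : ∀ δ ∈ Set.Ioc ε 1, 0 < f δ

/-- A probability distribution supported in `[0, 1]`. -/
structure IsUnitLaw (ν : Measure ℝ) : Prop where
  prob : IsProbabilityMeasure ν
  supp : ∀ᵐ x ∂ν, x ∈ Set.Icc (0 : ℝ) 1

/-- A stochastic bandit problem with `K` arms and rewards in `[0, 1]`. -/
structure Bandit (K : ℕ) where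
  law : Fin K → Measure ℝ
  isUnitLaw : ∀ a, IsUnitLaw (law a)

/-- A play history, most recent round first: the arm played, and whether the
(randomly rounded) reward was one. -/
abbrev History (K : ℕ) := List (Fin K × Bool)

/-- The number of past plays of arm `a`. -/
def pulls {K : ℕ} (h : History K) (a : Fin K) : ℕ := h.countP (fun r => r.1 = a)

/-- The sum of the past (rounded) rewards of arm `a`. -/
def successes {K : ℕ} (h : History K) (a : Fin K) : ℕ := h.countP (fun r => r.1 = a ∧ r.2 = true)

/-- The empirical mean of arm `a`; it is `0 / 0 = 0` if `a` has not been played. -/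
def empMean {K : ℕ} (h : History K) (a : Fin K) : ℝ := (successes h a : ℝ) / (pulls h a : ℝ)

/-- The first parameter of the Beta posterior. -/
def alphaParam {K : ℕ} (ε : ℝ) (h : History K) (a : Fin K) : ℝ :=
  (⌊(successes h a : ℝ) / (1 - ε)⌋₊ : ℝ) + 1

/-- The second parameter of the Beta posterior. -/
def betaParam {K : ℕ} (ε : ℝ) (h : History K) (a : Fin K) : ℝ :=
  (pulls h a : ℝ) + 2 - alphaParam ε h a

open Classical in
/-- The law of the index `θ_a` that `ε`-TS draws for arm `a` after the history `h`. -/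
def posterior {K : ℕ} (ε : ℝ) (h : History K) (a : Fin K) : Measure ℝ :=
  if 1 - ε < empMean h a then Measure.dirac (empMean h a)
  else (betaMeasure (alphaParam ε h a) (betaParam ε h a)).map (fun y => (1 - ε) * y)

lemma successes_le_pulls {K : ℕ} (h : History K) (a : Fin K) : successes h a ≤ pulls h a := by
  refine List.countP_mono_left ?_
  intro x _ hx
  simp only [decide_eq_true_eq] at hx ⊢
  exact hx.1

lemma betaParam_pos {K : ℕ} (ε : ℝ) (h : History K) (a : Fin K)
    (hh : ¬ 1 - ε < empMean h a) : 0 < betaParam ε h a := by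
  have hle := successes_le_pulls h a
  have key : ⌊(successes h a : ℝ) / (1 - ε)⌋₊ ≤ pulls h a := by
    refine Nat.floor_le_of_le ?_
    rw [not_lt, empMean] at hh
    have h0 : 0 ≤ (successes h a : ℝ) / (pulls h a : ℝ) := by positivity
    rcases (h0.trans hh).eq_or_lt with h1 | h1
    · rw [← h1]; simp
    · rw [div_le_iff₀ h1]
      rcases Nat.eq_zero_or_pos (pulls h a) with h2 | h2
      · have : successes h a = 0 := by omega
        simp [this, h2]
      · have h3 : (0 : ℝ) < pulls h a := by exact_mod_cast h2
        rw [div_le_iff₀ h3] at hh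
        linarith
  have key' : (⌊(successes h a : ℝ) / (1 - ε)⌋₊ : ℝ) ≤ pulls h a := by exact_mod_cast key
  unfold betaParam alphaParam
  linarith

instance posterior_isProbabilityMeasure {K : ℕ} (ε : ℝ) (h : History K) (a : Fin K) :
    IsProbabilityMeasure (posterior ε h a) := by
  unfold posterior
  split_ifs with hh
  · infer_instance
  · have h1 : 0 < alphaParam ε h a := by unfold alphaParam; positivity
    have := isProbabilityMeasureBeta h1 (betaParam_pos ε h a hh)
    exact Measure.isProbabilityMeasure_map (by fun_prop)

/-- The set of maximizers of an index vector. -/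
def argmaxSet {K : ℕ} (θ : Fin K → ℝ) : Finset (Fin K) :=
  open Classical in Finset.univ.filter (fun a => ∀ b, θ b ≤ θ a)

lemma argmaxSet_nonempty {K : ℕ} [NeZero K] (θ : Fin K → ℝ) : (argmaxSet θ).Nonempty := by
  obtain ⟨a, -, ha⟩ := Finset.exists_max_image Finset.univ θ Finset.univ_nonempty
  exact ⟨a, by simpa [argmaxSet] using ha⟩

/-- The arm played given the index vector `θ`: uniform on the maximizers of `θ`. -/
def tieBreak {K : ℕ} [NeZero K] (θ : Fin K → ℝ) : PMF (Fin K) :=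
  PMF.uniformOfFinset (argmaxSet θ) (argmaxSet_nonempty θ)

lemma measurable_argmaxSet {K : ℕ} : Measurable[_, ⊤] (argmaxSet (K := K)) := by
  classical
  have : ∀ s : Finset (Fin K), MeasurableSet {θ : Fin K → ℝ | argmaxSet θ = s} := by
    intro s
    have hs : {θ : Fin K → ℝ | argmaxSet θ = s}
        = ⋂ a : Fin K, {θ | (∀ b, θ b ≤ θ a) ↔ a ∈ s} := by
      ext θ
      simp [Finset.ext_iff, argmaxSet]
    rw [hs]
    refine MeasurableSet.iInter fun a => ?_
    have hm : MeasurableSet {θ : Fin K → ℝ | ∀ b, θ b ≤ θ a} := by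
      rw [Set.ofPred_forall]
      exact MeasurableSet.iInter fun b =>
        measurableSet_le (measurable_pi_apply b) (measurable_pi_apply a)
    by_cases ha : a ∈ s
    · simpa [ha] using hm
    · simp only [ha, iff_false]
      exact hm.compl
  let _ : MeasurableSpace (Finset (Fin K)) := ⊤
  exact measurable_to_countable' fun s => this s

lemma measurable_tieBreak {K : ℕ} [NeZero K] (a : Fin K) :
    Measurable (fun θ : Fin K → ℝ => tieBreak θ a) := by
  classical
  have : (fun θ : Fin K → ℝ => tieBreak θ a)
      = (fun s : Finset (Fin K) => if a ∈ s then (s.card : ℝ≥0∞)⁻¹ else 0) ∘ argmaxSet := by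
    funext θ
    simp [tieBreak]
  rw [this]
  let _ : MeasurableSpace (Finset (Fin K)) := ⊤
  exact (measurable_from_top).comp measurable_argmaxSet

/-- The law of the arm played by `ε`-TS after the history `h`: the indices `θ_a` are drawn
independently from the posteriors, and a maximizer is played, ties being broken uniformly. -/
def playLaw {K : ℕ} [NeZero K] (ε : ℝ) (h : History K) : PMF (Fin K) :=
  PMF.ofFintype (fun a => ∫⁻ θ, tieBreak θ a ∂(Measure.pi (posterior ε h))) (by
    rw [← lintegral_finsetSum _ (fun a _ => measurable_tieBreak a)]
    have h1 : ∀ θ : Fin K → ℝ, ∑ a, tieBreak θ a = 1 := fun θ => by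
      rw [← tsum_fintype (L := .unconditional _)]; exact (tieBreak θ).tsum_coe
    simp [h1])

namespace Bandit

variable {K : ℕ}

/-- The law of the rounded reward of arm `a`: a reward `X` is drawn from the law of the arm
and, given `X`, it is rounded to one with probability `X` and to zero with probability `1 - X`.
For a reward with values in `{0, 1}` this changes nothing. -/
def rewardLaw (B : Bandit K) (a : Fin K) : PMF Bool :=
  PMF.ofFintype (fun b => ∫⁻ x, ENNReal.ofReal (if b then x else 1 - x) ∂(B.law a)) (by
    have := (B.isUnitLaw a).prob
    rw [Fintype.sum_bool, ← lintegral_add_left (by simp only [if_true]; fun_prop)]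
    rw [lintegral_congr_ae (g := fun _ => 1), lintegral_const, measure_univ, mul_one]
    filter_upwards [(B.isUnitLaw a).supp] with x hx
    rw [← ENNReal.ofReal_add (by simpa using hx.1) (by simpa using hx.2)]
    simp)

/-- The mean reward of arm `a`. -/
def mean (B : Bandit K) (a : Fin K) : ℝ := ∫ x, x ∂(B.law a)

/-- The mean of an optimal arm. -/
def optMean (B : Bandit K) : ℝ := ⨆ a, B.mean a

/-- The suboptimality gap of arm `a`. -/
def gap (B : Bandit K) (a : Fin K) : ℝ := B.optMean - B.mean a

/-- The joint law of the arms played and the rewards observed by `ε`-TS in the first `t` rounds. -/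
def runLaw [NeZero K] (B : Bandit K) (ε : ℝ) : ℕ → PMF (History K)
  | 0 => PMF.pure []
  | t + 1 => (B.runLaw ε t).bind fun h =>
      (playLaw ε h).bind fun a => (B.rewardLaw a).bind fun x => PMF.pure ((a, x) :: h)

/-- The lenient regret `R_f(T)` of `ε`-TS with respect to `f`: the expectation of
`∑_{t ≤ T} f(Δ_{a_t})`. (The law of the first `T` rounds has finite support.) -/
def lenientRegret [NeZero K] (B : Bandit K) (ε : ℝ) (f : ℝ → ℝ) (T : ℕ) : ℝ :=
  ∑' h : History K, (B.runLaw ε T h).toReal * (h.map fun r => f (B.gap r.1)).sum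

/-- The sum of `f(Δ_a) / D a` over the arms with `Δ_a > ε`. -/
def gapSum (B : Bandit K) (ε : ℝ) (f : ℝ → ℝ) (D : Fin K → ℝ≥0∞) : ℝ≥0∞ :=
  open Classical in ∑ a with ε < B.gap a, ENNReal.ofReal (f (B.gap a)) / D a

end Bandit

/-- `K_inf(ν, x, D)`: the infimum of `KL(ν, ν')` over the distributions `ν'` of `D` with mean
greater than `x`; it is `∞` if there are none. -/
def kInf (ν : Measure ℝ) (x : ℝ) (D : Set (Measure ℝ)) : ℝ≥0∞ :=
  ⨅ ν' ∈ D, ⨅ _ : x < ∫ y, y ∂ν', InformationTheory.klDiv ν ν'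

end LenientBandit

end

/-!
The rounded rewards are Bernoulli variables, so the histories form a Markov chain determined by the
means of the arms, and expected sums along it are bounded by potential functions of the counts of an
arm. Let `a` be an arm with gap greater than `ε` and `o` an optimal arm.

Given the past the indices are independent, so for every level `y` the probability of playing `a` is
at most the probability of playing `o` times the odds that `θ_o ≤ y`, plus the probability that
`θ_a > y`. By the duality of Beta and binomial tails, these odds are at most the inverse likelihood
of the successes of `o`, up to an error decaying geometrically in the number of plays of `o`. For
`y < μ^* (1 - ε)` the expectation of this inverse likelihood after `n` plays also decays
geometrically, so that the first term contributes `O(1)` plays of `a` altogether.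

If `μ^* ≤ 1 - ε`, the level `y` has to approach `μ^*` instead. This is possible for as long as `o`
is not underestimated, the odds then decaying geometrically in the number of plays of `o`. The
second term is at most `1 / T` once `a` has been played about
`log T / d(μ_a / (1 - ε), μ^* / (1 - ε))` times. The lower level is needed only while `a` has been
played `O(log T)` times and `o`, although played `m` times, is underestimated; the expected number
of such plays is an arbitrarily small fraction of `log T` for large `m`.

If `μ^* > 1 - ε`, then `a` is never played when both `a` and `o` have empirical means on their own
side of `1 - ε`. While `o` is underestimated, the second term is exponentially small in the number
of plays of `o` if `a` has been played much more often, and the remaining plays of `a` have bounded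
expectation by the exponential concentration of the successes of `o`.

The absolute constant `4` is the square of a stretching factor: moving `μ^*` to `μ^* + ε` multiplies
the distance to `μ_a` by at most `2`.
-/


noncomputable section

namespace LenientBandit

open InformationTheory

/-! ### Means and gaps -/

namespace Bandit

variable {K : ℕ} (B : Bandit K) (a : Fin K)

lemma integrable_id_law : Integrable (fun x : ℝ => x) (B.law a) := by
  have := (B.isUnitLaw a).prob
  refine Integrable.of_bound (C := 1) (by fun_prop) ?_
  filter_upwards [(B.isUnitLaw a).supp] with x hx
  rw [Real.norm_eq_abs, abs_of_nonneg hx.1]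
  exact hx.2

lemma mean_nonneg : 0 ≤ B.mean a :=
  integral_nonneg_of_ae (by filter_upwards [(B.isUnitLaw a).supp] with x hx using hx.1)

lemma mean_le_one : B.mean a ≤ 1 := by
  have := (B.isUnitLaw a).prob
  have h : B.mean a ≤ ∫ _, (1 : ℝ) ∂(B.law a) :=
    integral_mono_ae (B.integrable_id_law a) (integrable_const _)
      (by filter_upwards [(B.isUnitLaw a).supp] with x hx using hx.2)
  simpa using h

/-- The means of the arms as points of the unit interval. The law of a run of `ε`-TS depends on
the bandit only through these, since the rounded rewards are Bernoulli variables. -/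
def means : Fin K → unitInterval := fun a => ⟨B.mean a, B.mean_nonneg a, B.mean_le_one a⟩

lemma mean_le_optMean : B.mean a ≤ B.optMean :=
  le_ciSup (Set.finite_range _).bddAbove a

lemma exists_mean_eq_optMean [NeZero K] : ∃ a, B.mean a = B.optMean :=
  exists_eq_ciSup_of_finite

lemma optMean_le_one : B.optMean ≤ 1 :=
  Real.iSup_le B.mean_le_one zero_le_one

lemma gap_nonneg : 0 ≤ B.gap a :=
  sub_nonneg.2 (B.mean_le_optMean a)

lemma gap_le_one : B.gap a ≤ 1 := by
  unfold gap
  linarith [B.optMean_le_one, B.mean_nonneg a]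

lemma rewardLaw_true : B.rewardLaw a true = ENNReal.ofReal (B.mean a) := by
  rw [mean, ofReal_integral_eq_lintegral_ofReal (B.integrable_id_law a)
    (by filter_upwards [(B.isUnitLaw a).supp] with x hx using hx.1)]
  simp [rewardLaw]

lemma rewardLaw_false : B.rewardLaw a false = ENNReal.ofReal (1 - B.mean a) := by
  have h := (B.rewardLaw a).tsum_coe
  rw [tsum_fintype, Fintype.sum_bool, rewardLaw_true] at h
  rw [ENNReal.ofReal_sub _ (B.mean_nonneg a), ENNReal.ofReal_one, ← h,
    ENNReal.add_sub_cancel_left ENNReal.ofReal_ne_top]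

end Bandit

lemma IsGapFunction.nonneg {ε δ : ℝ} {f : ℝ → ℝ} (hf : IsGapFunction ε f)
    (hδ : δ ∈ Set.Icc (0 : ℝ) 1) : 0 ≤ f δ := by
  rcases le_or_gt δ ε with h | h
  · exact (hf.eq_zero δ ⟨hδ.1, h⟩).ge
  · exact (hf.pos δ ⟨h, hδ.2⟩).le

lemma IsGapFunction.gap_nonneg {K : ℕ} {ε : ℝ} {f : ℝ → ℝ} (hf : IsGapFunction ε f)
    (B : Bandit K) (a : Fin K) : 0 ≤ f (B.gap a) :=
  hf.nonneg ⟨B.gap_nonneg a, B.gap_le_one a⟩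

/-! ### Policies on Bernoulli bandits -/

section Policy

variable {K : ℕ} (π : History K → PMF (Fin K)) (p : Fin K → unitInterval)

/-- The probability, as a real number, that the policy `π` plays arm `a` after the history `h`. -/
def playProb (h : History K) (a : Fin K) : ℝ := (π h a).toReal

lemma playProb_nonneg (h : History K) (a : Fin K) : 0 ≤ playProb π h a := ENNReal.toReal_nonneg

lemma sum_playProb_mul (h : History K) (c : ℝ) : ∑ a, playProb π h a * c = c := by
  have h1 := (π h).tsum_coe
  rw [tsum_fintype] at h1
  simp only [playProb]
  rw [← Finset.sum_mul, ← ENNReal.toReal_sum fun a _ => PMF.apply_ne_top _ _, h1,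
    ENNReal.toReal_one, one_mul]

/-- The conditional expectation of `φ` of the history one round later, given the current history
`h` and that arm `a`, a Bernoulli arm with mean `p a`, is played. -/
def afterPlay (a : Fin K) (φ : History K → ℝ) (h : History K) : ℝ :=
  p a * φ ((a, true) :: h) + (1 - p a) * φ ((a, false) :: h)

lemma afterPlay_mono (a : Fin K) : Monotone (afterPlay p a) := fun φ ψ hφψ h => by
  have h0 := (p a).2.1
  have h1 := sub_nonneg.2 (p a).2.2
  unfold afterPlay
  gcongr <;> exact hφψ _

lemma afterPlay_eq_of_forall_eq {a : Fin K} {φ : History K → ℝ} {h : History K} {c : ℝ}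
    (hφ : ∀ x, φ ((a, x) :: h) = c) : afterPlay p a φ h = c := by
  rw [afterPlay, hφ, hφ]
  ring

/-- The transition operator of the Markov chain of histories generated by the policy `π` on
Bernoulli arms with means `p`: the conditional expectation, given the current history, of a
function of the history one round later. -/
def transition : Module.End ℝ (History K → ℝ) where
  toFun φ h := ∑ a, playProb π h a * afterPlay p a φ h
  map_add' φ ψ := by
    funext h
    simp only [afterPlay, Pi.add_apply, ← Finset.sum_add_distrib]
    exact Finset.sum_congr rfl fun a _ => by ring
  map_smul' c φ := by
    funext h
    simp only [afterPlay, Pi.smul_apply, smul_eq_mul, RingHom.id_apply, Finset.mul_sum]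
    exact Finset.sum_congr rfl fun a _ => by ring

lemma transition_apply (φ : History K → ℝ) (h : History K) :
    transition π p φ h = ∑ a, playProb π h a * afterPlay p a φ h := rfl

lemma transition_mono : Monotone (transition π p) := fun φ ψ hφψ h => by
  simp only [transition_apply]
  exact Finset.sum_le_sum fun a _ =>
    mul_le_mul_of_nonneg_left (afterPlay_mono p a hφψ h) (playProb_nonneg π h a)

lemma transition_const (c : ℝ) : transition π p (fun _ => c) = fun _ => c := by
  funext h
  have hc : ∀ a, afterPlay p a (fun _ => c) h = c :=
    fun a => afterPlay_eq_of_forall_eq p fun _ => rfl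
  simp only [transition_apply, hc, sum_playProb_mul]

lemma transition_pow_mono (t : ℕ) : Monotone (transition π p ^ t) := by
  rw [Module.End.coe_pow]
  exact (transition_mono π p).iterate t

lemma transition_pow_const (t : ℕ) (c : ℝ) : (transition π p ^ t) (fun _ => c) = fun _ => c := by
  rw [Module.End.coe_pow]
  exact Function.iterate_fixed (transition_const π p c) t

/-- The expected sum of a function of the history over the histories before each of the first
`T` rounds. -/
def expectedSum (T : ℕ) : (History K → ℝ) →ₗ[ℝ] ℝ :=
  ∑ t ∈ Finset.range T, LinearMap.proj [] ∘ₗ transition π p ^ t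

lemma expectedSum_apply (T : ℕ) (ψ : History K → ℝ) :
    expectedSum π p T ψ = ∑ t ∈ Finset.range T, (transition π p ^ t) ψ [] := by
  simp [expectedSum, LinearMap.sum_apply]

lemma expectedSum_mono (T : ℕ) : Monotone (expectedSum π p T) := fun φ ψ hφψ => by
  simp only [expectedSum_apply]
  exact Finset.sum_le_sum fun t _ => transition_pow_mono π p t hφψ []

lemma expectedSum_nonneg (T : ℕ) {ψ : History K → ℝ} (hψ : 0 ≤ ψ) : 0 ≤ expectedSum π p T ψ :=
  (map_zero (expectedSum π p T)).ge.trans (expectedSum_mono π p T hψ)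

lemma expectedSum_const (T : ℕ) (c : ℝ) : expectedSum π p T (fun _ => c) = T * c := by
  simp [expectedSum_apply, transition_pow_const]

lemma expectedSum_transition_sub (T : ℕ) (φ : History K → ℝ) :
    expectedSum π p T (transition π p φ - φ) = (transition π p ^ T) φ [] - φ [] := by
  simp only [map_sub, expectedSum_apply, ← Module.End.mul_apply, ← pow_succ]
  rw [← Finset.sum_sub_distrib]
  exact Finset.sum_range_sub (fun t => (transition π p ^ t) φ []) T

/-- `Φ t` pays for the sum over the next `t` rounds: each round may cost what `Φ` loses in it. -/
lemma expectedSum_le_of_potential {ψ : History K → ℝ} (Φ : ℕ → History K → ℝ) (hΦ0 : 0 ≤ Φ 0)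
    (hΦ : ∀ t, ψ + transition π p (Φ t) ≤ Φ (t + 1)) (T : ℕ) :
    expectedSum π p T ψ ≤ Φ T [] := by
  suffices H : ∀ T, ∑ t ∈ Finset.range T, (transition π p ^ t) ψ ≤ Φ T by
    rw [expectedSum_apply, ← Finset.sum_apply]
    exact H T []
  intro T
  induction T with
  | zero => simpa using hΦ0
  | succ T ih =>
    calc ∑ t ∈ Finset.range (T + 1), (transition π p ^ t) ψ
        = ψ + transition π p (∑ t ∈ Finset.range T, (transition π p ^ t) ψ) := by
          simp only [Finset.sum_range_succ', pow_zero, Module.End.one_apply, map_sum, pow_succ',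
            Module.End.mul_apply, add_comm]
      _ ≤ ψ + transition π p (Φ T) := add_le_add_right (transition_mono π p ih) ψ
      _ ≤ Φ (T + 1) := hΦ T

end Policy

/-! ### The lenient regret as an expected sum -/

section Tsum

variable {α β : Type*}

lemma tsum_bind_mul (μ : PMF α) (κ : α → PMF β) (φ : β → ℝ≥0∞) :
    ∑' b, (μ.bind κ) b * φ b = ∑' a, μ a * ∑' b, κ a b * φ b := by
  simp only [PMF.bind_apply, ← ENNReal.tsum_mul_right, ← ENNReal.tsum_mul_left]
  rw [ENNReal.tsum_comm]
  simp only [mul_assoc]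

lemma tsum_pure_mul (x : α) (φ : α → ℝ≥0∞) : ∑' b, (PMF.pure x) b * φ b = φ x := by
  rw [tsum_eq_single x (fun b hb => by simp [PMF.pure_apply, hb])]
  simp

end Tsum

namespace Bandit

variable {K : ℕ} [NeZero K] (B : Bandit K) (ε : ℝ)

lemma tsum_playLaw_mul_tsum_rewardLaw (h : History K) {φ : History K → ℝ} (hφ : 0 ≤ φ) :
    ∑' a, playLaw ε h a * ∑' x, B.rewardLaw a x * ENNReal.ofReal (φ ((a, x) :: h))
      = ENNReal.ofReal (transition (playLaw ε) B.means φ h) := by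
  have h0 := fun a => (B.means a).2.1
  have h1 := fun a => sub_nonneg.2 (B.means a).2.2
  have hafter : ∀ a, 0 ≤ afterPlay B.means a φ h :=
    fun a => add_nonneg (mul_nonneg (h0 a) (hφ _)) (mul_nonneg (h1 a) (hφ _))
  rw [tsum_fintype, transition_apply, ENNReal.ofReal_sum_of_nonneg
    fun a _ => mul_nonneg (playProb_nonneg _ _ _) (hafter a)]
  refine Finset.sum_congr rfl fun a _ => ?_
  rw [tsum_fintype, Fintype.sum_bool, rewardLaw_true, rewardLaw_false,
    ENNReal.ofReal_mul (playProb_nonneg _ _ _), afterPlay,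
    ENNReal.ofReal_add (mul_nonneg (h0 a) (hφ _)) (mul_nonneg (h1 a) (hφ _)),
    ENNReal.ofReal_mul (h0 a), ENNReal.ofReal_mul (h1 a), playProb,
    ENNReal.ofReal_toReal (PMF.apply_ne_top _ _)]
  rfl

lemma tsum_runLaw_mul (t : ℕ) {φ : History K → ℝ} (hφ : 0 ≤ φ) :
    ∑' h, B.runLaw ε t h * ENNReal.ofReal (φ h)
      = ENNReal.ofReal ((transition (playLaw ε) B.means ^ t) φ []) := by
  induction t generalizing φ with
  | zero => exact tsum_pure_mul ([] : History K) fun h => ENNReal.ofReal (φ h)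
  | succ t ih =>
    have hstep : 0 ≤ transition (playLaw ε) B.means φ :=
      (map_zero (transition (playLaw ε) B.means)).ge.trans (transition_mono _ _ hφ)
    rw [pow_succ, Module.End.mul_apply, ← ih hstep, runLaw, tsum_bind_mul]
    simp only [tsum_bind_mul, tsum_pure_mul, tsum_playLaw_mul_tsum_rewardLaw B ε _ hφ]

lemma tsum_runLaw_toReal_mul (t : ℕ) {φ : History K → ℝ} (hφ : 0 ≤ φ) :
    ∑' h, (B.runLaw ε t h).toReal * φ h = (transition (playLaw ε) B.means ^ t) φ [] := by
  have hpow : 0 ≤ (transition (playLaw ε) B.means ^ t) φ :=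
    (map_zero (transition (playLaw ε) B.means ^ t)).ge.trans (transition_pow_mono _ _ t hφ)
  rw [← ENNReal.toReal_ofReal (hpow []), ← B.tsum_runLaw_mul ε t hφ, ENNReal.tsum_toReal_eq
    fun h => ENNReal.mul_ne_top (PMF.apply_ne_top _ _) ENNReal.ofReal_ne_top]
  exact tsum_congr fun h => by rw [ENNReal.toReal_mul, ENNReal.toReal_ofReal (hφ h)]

lemma lenientRegret_eq_sum {f : ℝ → ℝ} (hf : ∀ a, 0 ≤ f (B.gap a)) (T : ℕ) :
    B.lenientRegret ε f T = ∑ a, f (B.gap a) *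
      expectedSum (playLaw ε) B.means T (fun h => playProb (playLaw ε) h a) := by
  set φ : History K → ℝ := fun h => (h.map fun r => f (B.gap r.1)).sum with hφ
  have hφ0 : 0 ≤ φ := fun h => List.sum_nonneg fun x hx => by
    obtain ⟨r, -, rfl⟩ := List.mem_map.1 hx
    exact hf r.1
  have hdrift : transition (playLaw ε) B.means φ - φ
      = ∑ a, f (B.gap a) • fun h => playProb (playLaw ε) h a := by
    funext h
    rw [Pi.sub_apply, ← sum_playProb_mul (playLaw ε) h (φ h), transition_apply,
      ← Finset.sum_sub_distrib, Finset.sum_apply]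
    refine Finset.sum_congr rfl fun a _ => ?_
    simp only [hφ, afterPlay, List.map_cons, List.sum_cons, Pi.smul_apply, smul_eq_mul]
    ring
  calc B.lenientRegret ε f T
      = (transition (playLaw ε) B.means ^ T) φ [] - φ [] := by
        rw [← B.tsum_runLaw_toReal_mul ε T hφ0]
        simp [lenientRegret, hφ]
    _ = _ := by
        simp only [← expectedSum_transition_sub, hdrift, map_sum, map_smul, smul_eq_mul]

end Bandit

/-! ### Potentials -/

section Counts

variable {K : ℕ} (h : History K) (a : Fin K)

lemma pulls_cons_self (x : Bool) : pulls ((a, x) :: h) a = pulls h a + 1 := by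
  simp [pulls]

lemma successes_cons_true : successes ((a, true) :: h) a = successes h a + 1 := by
  simp [successes]

lemma successes_cons_false : successes ((a, false) :: h) a = successes h a := by
  simp [successes]

variable {a} {b : Fin K}

lemma pulls_cons_of_ne (hab : b ≠ a) (x : Bool) : pulls ((b, x) :: h) a = pulls h a := by
  simp [pulls, hab]

lemma successes_cons_of_ne (hab : b ≠ a) (x : Bool) :
    successes ((b, x) :: h) a = successes h a := by
  simp [successes, hab]

end Counts

/-- The expected value of `g` after one more Bernoulli trial with success probability `p`,
in terms of the numbers of trials and of successes so far. -/
def trial (p : ℝ) (g : ℕ → ℕ → ℝ) (n s : ℕ) : ℝ := p * g (n + 1) (s + 1) + (1 - p) * g (n + 1) s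

lemma iterate_trial (p : ℝ) (g : ℕ → ℕ → ℝ) (j n s : ℕ) : (trial p)^[j] g n s
    = ∑ i ∈ Finset.HasAntidiagonal.antidiagonal j,
        (j.choose i.1 : ℝ) * (p ^ i.1 * (1 - p) ^ i.2 * g (n + j) (s + i.1)) := by
  induction j generalizing n s with
  | zero => simp
  | succ j ih =>
    rw [Function.iterate_succ_apply', trial, ih, ih,
      Finset.sum_antidiagonal_choose_succ_mul
        fun i k => p ^ i * (1 - p) ^ k * g (n + (j + 1)) (s + i),
      add_comm, Finset.mul_sum, Finset.mul_sum]
    congr 1 <;> refine Finset.sum_congr rfl fun i hi => ?_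
    · rw [Nat.add_right_comm, Nat.add_assoc n j 1]
      ring
    · rw [Nat.choose_symm_of_eq_add (Finset.HasAntidiagonal.mem_antidiagonal.1 hi).symm,
        Nat.add_right_comm n,
        Nat.add_right_comm s, Nat.add_assoc n j 1, Nat.add_assoc s i.1 1]
      ring

lemma iterate_trial_nonneg (p : unitInterval) {g : ℕ → ℕ → ℝ} (hg : ∀ n s, 0 ≤ g n s)
    (j n s : ℕ) : 0 ≤ (trial p)^[j] g n s := by
  rw [iterate_trial]
  have h0 := p.2.1
  have h1 := sub_nonneg.2 p.2.2
  exact Finset.sum_nonneg fun i _ => mul_nonneg (Nat.cast_nonneg _)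
    (mul_nonneg (by positivity) (hg _ _))

section Potential

variable {K : ℕ} (π : History K → PMF (Fin K)) (p : Fin K → unitInterval)

lemma afterPlay_counts_self (g : ℕ → ℕ → ℝ) (a : Fin K) (h : History K) :
    afterPlay p a (fun h => g (pulls h a) (successes h a)) h
      = trial (p a) g (pulls h a) (successes h a) := by
  simp only [afterPlay, trial, pulls_cons_self, successes_cons_true, successes_cons_false]

lemma afterPlay_counts_of_ne (g : ℕ → ℕ → ℝ) {a b : Fin K} (hb : b ≠ a) (h : History K) :
    afterPlay p b (fun h => g (pulls h a) (successes h a)) h = g (pulls h a) (successes h a) :=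
  afterPlay_eq_of_forall_eq p fun x => by
    simp only [pulls_cons_of_ne h hb, successes_cons_of_ne h hb]

lemma expectedSum_play_le_of_potential (a : Fin K) {c : History K → ℝ} (Φ : ℕ → History K → ℝ)
    (hΦ0 : 0 ≤ Φ 0) (hself : ∀ t h, c h + afterPlay p a (Φ t) h ≤ Φ (t + 1) h)
    (hother : ∀ t h, ∀ b ≠ a, afterPlay p b (Φ t) h ≤ Φ (t + 1) h) (T : ℕ) :
    expectedSum π p T (fun h => playProb π h a * c h) ≤ Φ T [] := by
  classical
  refine expectedSum_le_of_potential π p Φ hΦ0 (fun t h => ?_) T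
  calc playProb π h a * c h + transition π p (Φ t) h
      = ∑ b, playProb π h b * ((if b = a then c h else 0) + afterPlay p b (Φ t) h) := by
        simp [transition_apply, mul_add, Finset.sum_add_distrib]
    _ ≤ ∑ b, playProb π h b * Φ (t + 1) h := by
        refine Finset.sum_le_sum fun b _ => mul_le_mul_of_nonneg_left ?_ (playProb_nonneg π h b)
        split_ifs with hba
        · exact hba ▸ hself t h
        · exact (zero_add _).trans_le (hother t h b hba)
    _ = Φ (t + 1) h := sum_playProb_mul π h _

lemma expectedSum_play_le_sum_trial (a : Fin K) {g : ℕ → ℕ → ℝ} (hg : ∀ n s, 0 ≤ g n s) (T : ℕ) :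
    expectedSum π p T (fun h => playProb π h a * g (pulls h a) (successes h a))
      ≤ ∑ j ∈ Finset.range T, (trial (p a))^[j] g 0 0 := by
  let G : ℕ → ℕ → ℕ → ℝ := fun t n s => ∑ j ∈ Finset.range t, (trial (p a))^[j] g n s
  have hG : ∀ t n s, g n s + trial (p a) (G t) n s = G (t + 1) n s := fun t n s => by
    simp only [G, trial, Finset.sum_range_succ', Function.iterate_zero_apply,
      Function.iterate_succ_apply', Finset.mul_sum, ← Finset.sum_add_distrib, add_comm]
  refine expectedSum_play_le_of_potential π p a (fun t h => G t (pulls h a) (successes h a))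
    (fun h => by simp [G]) (fun t h => ?_) (fun t h b hb => ?_) T
  · rw [afterPlay_counts_self p (G t), hG]
  · rw [afterPlay_counts_of_ne p (G t) hb]
    simp only [G, Finset.sum_range_succ]
    exact le_add_of_nonneg_right (iterate_trial_nonneg (p a) hg _ _ _)

lemma expectedSum_play_le_of_trial_le_mul (a : Fin K) {c : History K → ℝ} {w : ℕ → ℕ → ℝ} {ρ : ℝ}
    (hρ : ρ < 1) (hw0 : ∀ n s, 0 ≤ w n s) (hw : ∀ n s, trial (p a) w n s ≤ ρ * w n s)
    (hc : ∀ h, c h ≤ w (pulls h a) (successes h a)) (T : ℕ) :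
    expectedSum π p T (fun h => playProb π h a * c h) ≤ w 0 0 / (1 - ρ) := by
  have hρ' : 0 < 1 - ρ := sub_pos.2 hρ
  refine expectedSum_play_le_of_potential π p a
    (fun _ h => w (pulls h a) (successes h a) / (1 - ρ))
    (fun h => div_nonneg (hw0 _ _) hρ'.le) (fun _ h => ?_) (fun _ h b hb => ?_) T
  · rw [afterPlay_counts_self p fun n s => w n s / (1 - ρ)]
    calc c h + trial (p a) (fun n s => w n s / (1 - ρ)) (pulls h a) (successes h a)
        = c h + trial (p a) w (pulls h a) (successes h a) / (1 - ρ) := by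
          simp only [trial]
          ring
      _ ≤ w (pulls h a) (successes h a) + ρ * w (pulls h a) (successes h a) / (1 - ρ) := by
          gcongr
          exacts [hc h, hw _ _]
      _ = w (pulls h a) (successes h a) / (1 - ρ) := by
          field_simp
          ring
  · rw [afterPlay_counts_of_ne p (fun n s => w n s / (1 - ρ)) hb]

lemma expectedSum_play_mul_pow_le (a : Fin K) {C ρ : ℝ} (hC : 0 ≤ C) (hρ0 : 0 ≤ ρ) (hρ1 : ρ < 1)
    (T : ℕ) : expectedSum π p T (fun h => playProb π h a * (C * ρ ^ pulls h a)) ≤ C / (1 - ρ) := by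
  simpa using expectedSum_play_le_of_trial_le_mul π p a hρ1 (w := fun n _ => C * ρ ^ n)
    (fun n _ => by positivity) (fun n s => le_of_eq (by rw [trial]; ring)) (fun _ => le_rfl) T

lemma expectedSum_play_le_mul {a o : Fin K} (hao : a ≠ o) {c : History K → ℝ} {v : ℕ → ℝ}
    {u : ℕ → ℕ → ℝ} (hv0 : ∀ n, 0 ≤ v n) (hu0 : ∀ n s, 0 ≤ u n s)
    (hu : ∀ n s, trial (p o) u n s ≤ u n s)
    (hc : ∀ h, c h ≤ (v (pulls h a) - v (pulls h a + 1)) * u (pulls h o) (successes h o)) (T : ℕ) :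
    expectedSum π p T (fun h => playProb π h a * c h) ≤ v 0 * u 0 0 := by
  refine expectedSum_play_le_of_potential π p a
    (fun _ h => v (pulls h a) * u (pulls h o) (successes h o))
    (fun h => mul_nonneg (hv0 _) (hu0 _ _)) (fun _ h => ?_) (fun _ h b hba => ?_) T
  · rw [afterPlay_eq_of_forall_eq p (a := a)
      (c := v (pulls h a + 1) * u (pulls h o) (successes h o)) fun x => by
        rw [pulls_cons_self, pulls_cons_of_ne h hao, successes_cons_of_ne h hao]]
    linarith [hc h]
  · by_cases hbo : b = o
    · subst hbo
      calc afterPlay p b (fun h => v (pulls h a) * u (pulls h b) (successes h b)) h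
          = v (pulls h a) * trial (p b) u (pulls h b) (successes h b) := by
            simp only [← afterPlay_counts_self, afterPlay, pulls_cons_of_ne h hba]
            ring
        _ ≤ v (pulls h a) * u (pulls h b) (successes h b) :=
            mul_le_mul_of_nonneg_left (hu _ _) (hv0 _)
    · refine (afterPlay_eq_of_forall_eq p fun x => ?_).le
      rw [pulls_cons_of_ne h hba, pulls_cons_of_ne h hbo, successes_cons_of_ne h hbo]

lemma expectedSum_play_le_of_pulls_lt {a o : Fin K} (hao : a ≠ o) {c : History K → ℝ}
    {u : ℕ → ℕ → ℝ} {L : ℝ} (hL : 0 ≤ L) (hu0 : ∀ n s, 0 ≤ u n s)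
    (hu : ∀ n s, trial (p o) u n s ≤ u n s)
    (hc_lt : ∀ h, (pulls h a : ℝ) < L → c h ≤ u (pulls h o) (successes h o))
    (hc_ge : ∀ h, L ≤ (pulls h a : ℝ) → c h ≤ 0) (T : ℕ) :
    expectedSum π p T (fun h => playProb π h a * c h) ≤ (L + 1) * u 0 0 := by
  have hv : max (L + 1 - (0 : ℕ)) 0 = L + 1 := by
    rw [Nat.cast_zero, sub_zero, max_eq_left (by linarith)]
  refine (expectedSum_play_le_mul π p hao (v := fun n => max (L + 1 - n) 0)
    (fun n => le_max_right _ _) hu0 hu (fun h => ?_) T).trans_eq (by rw [hv])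
  have hcast : L + 1 - ((pulls h a + 1 : ℕ) : ℝ) = L - pulls h a := by
    push_cast
    ring
  rw [hcast]
  rcases lt_or_ge (pulls h a : ℝ) L with hlt | hge
  · rw [max_eq_left (by linarith), max_eq_left (by linarith)]
    linarith [hc_lt h hlt]
  · rw [max_eq_right (a := L - _) (by linarith), sub_zero]
    exact (hc_ge h hge).trans (mul_nonneg (le_max_right _ _) (hu0 _ _))

lemma expectedSum_play_le_of_pow_pulls {a o : Fin K} (hao : a ≠ o) {c : History K → ℝ}
    {u : ℕ → ℕ → ℝ} {q : ℝ} (hq0 : 0 ≤ q) (hq1 : q < 1) (hu0 : ∀ n s, 0 ≤ u n s)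
    (hu : ∀ n s, trial (p o) u n s ≤ u n s)
    (hc : ∀ h, c h ≤ q ^ pulls h a * u (pulls h o) (successes h o)) (T : ℕ) :
    expectedSum π p T (fun h => playProb π h a * c h) ≤ u 0 0 / (1 - q) := by
  have hq' : 0 < 1 - q := sub_pos.2 hq1
  refine (expectedSum_play_le_mul π p hao (v := fun n => q ^ n / (1 - q))
    (fun n => by positivity) hu0 hu (fun h => (hc h).trans_eq ?_) T).trans_eq ?_
  · field_simp
    ring
  · simp [div_eq_inv_mul]

end Potential

/-! ### Products of probability measures -/

section Pi

variable {ι : Type*} [Fintype ι] [DecidableEq ι] {X : ι → Type*} [∀ i, MeasurableSpace (X i)]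
  (ν : ∀ i, Measure (X i)) [∀ i, IsProbabilityMeasure (ν i)] (i : ι)

lemma lintegral_pi_eq_lintegral_update {f : (∀ i, X i) → ℝ≥0∞} (hf : Measurable f) :
    ∫⁻ θ, f θ ∂Measure.pi ν
      = ∫⁻ θ, ∫⁻ x, f (Function.update θ i x) ∂ν i ∂Measure.pi ν := by
  simp only [← lmarginal_singleton]
  refine lintegral_eq_of_lmarginal_eq {i} hf (hf.lmarginal ν) ?_
  simp [lmarginal_singleton]

lemma pi_eq_lintegral_update {s : Set (∀ i, X i)} (hs : MeasurableSet s) :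
    Measure.pi ν s = ∫⁻ θ, ν i (Function.update θ i ⁻¹' s) ∂Measure.pi ν := by
  rw [← lintegral_indicator_one hs,
    lintegral_pi_eq_lintegral_update ν i (measurable_one.indicator hs)]
  refine lintegral_congr fun θ => ?_
  exact lintegral_indicator_one (measurable_update θ hs)

lemma pi_inter_preimage_eval {s : Set (∀ i, X i)} (hs : MeasurableSet s)
    (hupdate : ∀ θ x, Function.update θ i x ∈ s ↔ θ ∈ s) {t : Set (X i)} (ht : MeasurableSet t) :
    Measure.pi ν (s ∩ Function.eval i ⁻¹' t) = Measure.pi ν s * ν i t := by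
  rw [pi_eq_lintegral_update ν i (hs.inter (measurable_pi_apply i ht)),
    ← setLIntegral_one s, ← lintegral_indicator hs,
    ← lintegral_mul_const _ (measurable_const.indicator hs)]
  refine lintegral_congr fun θ => ?_
  by_cases hθ : θ ∈ s
  · rw [Set.indicator_of_mem hθ, one_mul]
    congr 1
    ext x
    simp [hupdate, hθ]
  · simp [hupdate, hθ, Set.preimage]

end Pi

/-! ### The arm with the largest index -/

section Argmax

variable {K : ℕ} {θ : Fin K → ℝ} {a : Fin K}

lemma mem_argmaxSet : a ∈ argmaxSet θ ↔ ∀ b, θ b ≤ θ a := by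
  simp [argmaxSet]

variable [NeZero K]

lemma tieBreak_of_notMem (h : a ∉ argmaxSet θ) : tieBreak θ a = 0 := by
  simp [tieBreak, h]

lemma inv_card_le_tieBreak (h : a ∈ argmaxSet θ) : (K : ℝ≥0∞)⁻¹ ≤ tieBreak θ a := by
  rw [tieBreak, PMF.uniformOfFinset_apply_of_mem _ h]
  gcongr
  exact (Finset.card_le_univ _).trans (by simp)

lemma tieBreak_eq_one (h : ∀ b ≠ a, θ b < θ a) : tieBreak θ a = 1 := by
  have hsingle : argmaxSet θ = {a} := by
    ext b
    rw [mem_argmaxSet, Finset.mem_singleton]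
    constructor
    · intro hb
      by_contra hne
      exact (h b hne).not_ge (hb a)
    · rintro rfl c
      rcases eq_or_ne c b with rfl | hc
      exacts [le_rfl, (h c hc).le]
  simp [tieBreak, hsingle]

end Argmax

/-- The event that the index of arm `a` exceeds `y` and is not beaten by any arm other than `o`.
Exchanging the roles of `a` and `o` only changes the arm whose index is tested. -/
def leadSet {K : ℕ} (a o : Fin K) (y : ℝ) : Set (Fin K → ℝ) :=
  {θ | y < θ a ∧ ∀ b, b ≠ a → b ≠ o → θ b ≤ θ a}

/-- The odds that a random variable with law `μ` is at most `y`. -/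
def lowOdds (μ : Measure ℝ) (y : ℝ) : ℝ := μ.real (Set.Iic y) / μ.real (Set.Ioi y)

lemma lowOdds_nonneg (μ : Measure ℝ) (y : ℝ) : 0 ≤ lowOdds μ y := by
  unfold lowOdds
  positivity

section LeadSet

variable {K : ℕ} (a o : Fin K) (y : ℝ)

lemma measurableSet_leadSet : MeasurableSet (leadSet a o y) := by
  unfold leadSet
  measurability

lemma preimage_update_leadSet (θ : Fin K → ℝ) : Function.update θ a ⁻¹' leadSet a o y
    = {x | ∀ b, b ≠ a → b ≠ o → θ b ≤ x} ∩ Set.Ioi y := by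
  ext x
  simp only [leadSet, Set.mem_preimage, Set.mem_ofPred_eq, Function.update_self, Set.mem_inter_iff,
    Set.mem_Ioi, and_comm (a := y < x)]
  refine and_congr_left fun _ => forall_congr' fun b => imp_congr_right fun hb => ?_
  rw [Function.update_of_ne hb]

variable {a o} in
lemma update_mem_leadSet_iff (hao : a ≠ o) (θ : Fin K → ℝ) (x : ℝ) :
    Function.update θ o x ∈ leadSet a o y ↔ θ ∈ leadSet a o y := by
  simp only [leadSet, Set.mem_ofPred_eq, Function.update_of_ne hao]
  refine and_congr_right fun _ => forall_congr' fun b => imp_congr_right fun _ => ?_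
  exact imp_congr_right fun hb => by rw [Function.update_of_ne hb]

variable (ν : Fin K → Measure ℝ) [∀ a, IsProbabilityMeasure (ν a)]

lemma pi_leadSet_le : Measure.pi ν (leadSet a o y) ≤ ν a (Set.Ioi y) := by
  rw [← (measurePreserving_eval ν a).measure_preimage measurableSet_Ioi.nullMeasurableSet]
  exact measure_mono fun θ hθ => hθ.1

lemma pi_leadSet_le_mul_swap {r : ℝ≥0}
    (hr : ∀ s, MeasurableSet s → ν a (s ∩ Set.Ioi y) ≤ r * ν o (s ∩ Set.Ioi y)) :
    Measure.pi ν (leadSet a o y) ≤ r * Measure.pi ν (leadSet o a y) := by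
  rw [pi_eq_lintegral_update ν a (measurableSet_leadSet a o y),
    pi_eq_lintegral_update ν o (measurableSet_leadSet o a y),
    ← lintegral_const_mul' _ _ ENNReal.coe_ne_top]
  refine lintegral_mono fun θ => ?_
  have hswap : {x | ∀ b, b ≠ o → b ≠ a → θ b ≤ x} = {x | ∀ b, b ≠ a → b ≠ o → θ b ≤ x} :=
    Set.ext fun x => forall_congr' fun b => forall_comm
  simp only [preimage_update_leadSet, hswap]
  exact hr _ (by measurability)

end LeadSet

section WinProb

variable {K : ℕ} [NeZero K] (ν : Fin K → Measure ℝ) {a o : Fin K} (y : ℝ)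

/-- The probability that arm `a` is played if the indices are independent with laws `ν`. -/
def winProb (a : Fin K) : ℝ≥0∞ := ∫⁻ θ, tieBreak θ a ∂(Measure.pi ν)

lemma mul_pi_le_winProb {E : Set (Fin K → ℝ)} (hE : MeasurableSet E) {c : ℝ≥0∞}
    (hc : ∀ θ ∈ E, c ≤ tieBreak θ a) : c * Measure.pi ν E ≤ winProb ν a := by
  rw [← setLIntegral_const]
  exact (setLIntegral_mono' hE hc).trans (setLIntegral_le_lintegral _ _)

lemma winProb_le_pi (a : Fin K) : winProb ν a ≤ Measure.pi ν {θ | ∀ b, θ b ≤ θ a} := by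
  have hmeas : MeasurableSet {θ : Fin K → ℝ | ∀ b, θ b ≤ θ a} := by measurability
  rw [← lintegral_indicator_one hmeas]
  refine lintegral_mono fun θ => ?_
  by_cases hθ : θ ∈ {θ : Fin K → ℝ | ∀ b, θ b ≤ θ a}
  · rw [Set.indicator_of_mem hθ]
    exact PMF.coe_le_one _ _
  · rw [tieBreak_of_notMem (mt mem_argmaxSet.1 hθ)]
    exact zero_le

lemma winProb_le_pi_add_pi_leadSet (a o : Fin K) : winProb ν a
    ≤ Measure.pi ν {θ | ∀ b, θ b ≤ y} + Measure.pi ν (leadSet a o y) := by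
  refine (winProb_le_pi ν a).trans ((measure_mono fun θ hθ => ?_).trans (measure_union_le _ _))
  rcases le_or_gt (θ a) y with hy | hy
  exacts [.inl fun b => (hθ b).trans hy, .inr ⟨hy, fun b _ _ => hθ b⟩]

variable [∀ a, IsProbabilityMeasure (ν a)]

lemma winProb_ne_top : winProb ν a ≠ ∞ :=
  ((winProb_le_pi ν a).trans_lt (measure_lt_top _ _)).ne

/-- Both sides are governed by the event that the other indices are at most `y`, which is
independent of the index of `o`. -/
lemma pi_forall_le_mul_le (o : Fin K) : Measure.pi ν {θ | ∀ b, θ b ≤ y} * ν o (Set.Ioi y)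
    ≤ ν o (Set.Iic y) * winProb ν o := by
  set A : Set (Fin K → ℝ) := {θ | ∀ b, b ≠ o → θ b ≤ y}
  have hA : MeasurableSet A := by measurability
  have hupdate : ∀ θ x, Function.update θ o x ∈ A ↔ θ ∈ A := fun θ x =>
    forall_congr' fun b => imp_congr_right fun hb => by rw [Function.update_of_ne hb]
  have hIic : {θ : Fin K → ℝ | ∀ b, θ b ≤ y} = A ∩ Function.eval o ⁻¹' Set.Iic y := by
    ext θ
    refine ⟨fun h => ⟨fun b _ => h b, h o⟩, fun h b => ?_⟩
    rcases eq_or_ne b o with rfl | hb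
    exacts [h.2, h.1 b hb]
  have hIoi : Measure.pi ν (A ∩ Function.eval o ⁻¹' Set.Ioi y) ≤ winProb ν o := by
    simpa using mul_pi_le_winProb ν (hA.inter (measurable_pi_apply o measurableSet_Ioi))
      fun θ hθ => (tieBreak_eq_one fun b hb => (hθ.1 b hb).trans_lt hθ.2).ge
  calc Measure.pi ν {θ | ∀ b, θ b ≤ y} * ν o (Set.Ioi y)
      = ν o (Set.Iic y) * (Measure.pi ν A * ν o (Set.Ioi y)) := by
        rw [hIic, pi_inter_preimage_eval ν o hA hupdate measurableSet_Iic]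
        ring
    _ ≤ ν o (Set.Iic y) * winProb ν o := by
        rw [← pi_inter_preimage_eval ν o hA hupdate measurableSet_Ioi]
        gcongr

lemma pi_leadSet_mul_le_winProb (hao : a ≠ o) :
    Measure.pi ν (leadSet o a y) * ν a (Set.Iic y) ≤ K * winProb ν o := by
  have hmeas := measurableSet_leadSet o a y
  rw [← pi_inter_preimage_eval ν a hmeas (update_mem_leadSet_iff y hao.symm) measurableSet_Iic]
  refine (ENNReal.inv_mul_le_iff (Nat.cast_ne_zero.2 (NeZero.ne K)) (by finiteness)).1
    (mul_pi_le_winProb ν (hmeas.inter (measurable_pi_apply a measurableSet_Iic))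
      fun θ hθ => inv_card_le_tieBreak (mem_argmaxSet.2 fun b => ?_))
  rcases eq_or_ne b o with rfl | hbo
  · exact le_rfl
  rcases eq_or_ne b a with rfl | hba
  · exact hθ.2.trans hθ.1.1.le
  · exact hθ.1.2 b hbo hba

lemma toReal_winProb_le_add_leadSet (hy : 0 < (ν o).real (Set.Ioi y)) : (winProb ν a).toReal
    ≤ lowOdds (ν o) y * (winProb ν o).toReal + (Measure.pi ν).real (leadSet a o y) := by
  have hsplit : (winProb ν a).toReal
      ≤ (Measure.pi ν).real {θ | ∀ b, θ b ≤ y} + (Measure.pi ν).real (leadSet a o y) :=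
    ENNReal.toReal_le_add (winProb_le_pi_add_pi_leadSet ν y a o) (by finiteness) (by finiteness)
  have hlow : (Measure.pi ν).real {θ | ∀ b, θ b ≤ y} * (ν o).real (Set.Ioi y)
      ≤ (ν o).real (Set.Iic y) * (winProb ν o).toReal := by
    have htop := winProb_ne_top ν (a := o)
    simpa only [ENNReal.toReal_mul] using!
      ENNReal.toReal_mono (by finiteness) (pi_forall_le_mul_le ν y o)
  refine hsplit.trans (add_le_add_left ?_ _)
  rwa [lowOdds, div_mul_eq_mul_div, le_div_iff₀ hy]

lemma toReal_winProb_le_add_tail (hy : 0 < (ν o).real (Set.Ioi y)) : (winProb ν a).toReal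
    ≤ lowOdds (ν o) y * (winProb ν o).toReal + (ν a).real (Set.Ioi y) := by
  refine (toReal_winProb_le_add_leadSet ν y hy).trans ?_
  gcongr
  exact ENNReal.toReal_mono (measure_ne_top _ _) (pi_leadSet_le a o y ν)

lemma toReal_winProb_le_of_dominated (hao : a ≠ o) {r : ℝ≥0}
    (hy : 0 < (ν o).real (Set.Ioi y)) (hhalf : 1 / 2 ≤ (ν a).real (Set.Iic y))
    (hr : ∀ s, MeasurableSet s →
      ν a (s ∩ Set.Ioi y) ≤ r * ν o (s ∩ Set.Ioi y)) :
    (winProb ν a).toReal ≤ (lowOdds (ν o) y + 2 * r * K) * (winProb ν o).toReal := by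
  have hswap : (Measure.pi ν).real (leadSet a o y) ≤ r * (Measure.pi ν).real (leadSet o a y) := by
    simpa only [ENNReal.toReal_mul, ENNReal.coe_toReal] using!
      ENNReal.toReal_mono (by finiteness) (pi_leadSet_le_mul_swap a o y ν hr)
  have hwin : (Measure.pi ν).real (leadSet o a y) * (ν a).real (Set.Iic y)
      ≤ K * (winProb ν o).toReal := by
    have htop := winProb_ne_top ν (a := o)
    simpa only [ENNReal.toReal_mul, ENNReal.toReal_natCast] using!
      ENNReal.toReal_mono (by finiteness) (pi_leadSet_mul_le_winProb ν y hao)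
  have hlead : (Measure.pi ν).real (leadSet o a y) * (1 / 2) ≤ K * (winProb ν o).toReal :=
    (mul_le_mul_of_nonneg_left hhalf measureReal_nonneg).trans hwin
  linarith [toReal_winProb_le_add_leadSet ν (a := a) y hy,
    mul_le_mul_of_nonneg_left hlead r.coe_nonneg]

end WinProb

/-! ### Binomial and Beta tails -/

section BinomialTail

variable {n N k : ℕ} {x y l : ℝ}

/-- The distribution function of the binomial law: the probability of at most `k` successes in `N`
independent trials, as a function of the success probability `y`. -/
def binCDF (N k : ℕ) (y : ℝ) : ℝ :=
  ∑ i ∈ Finset.range (k + 1), (bernsteinPolynomial ℝ N i).eval y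

lemma eval_bernsteinPolynomial (N i : ℕ) (y : ℝ) :
    (bernsteinPolynomial ℝ N i).eval y = N.choose i * y ^ i * (1 - y) ^ (N - i) := by
  simp [bernsteinPolynomial]

lemma eval_bernsteinPolynomial_nonneg (N i : ℕ) (h0 : 0 ≤ y) (h1 : y ≤ 1) :
    0 ≤ (bernsteinPolynomial ℝ N i).eval y := by
  have := sub_nonneg.2 h1
  rw [eval_bernsteinPolynomial]
  positivity

lemma binCDF_nonneg (N k : ℕ) (h0 : 0 ≤ y) (h1 : y ≤ 1) : 0 ≤ binCDF N k y :=
  Finset.sum_nonneg fun i _ => eval_bernsteinPolynomial_nonneg N i h0 h1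

lemma eval_bernsteinPolynomial_le_binCDF (N : ℕ) {i k : ℕ} (hi : i ≤ k) (h0 : 0 ≤ y)
    (h1 : y ≤ 1) : (bernsteinPolynomial ℝ N i).eval y ≤ binCDF N k y :=
  Finset.single_le_sum (f := fun i => (bernsteinPolynomial ℝ N i).eval y)
    (fun i _ => eval_bernsteinPolynomial_nonneg N i h0 h1)
    (Finset.mem_range.2 (Nat.lt_succ_of_le hi))

lemma pow_le_binCDF (N k : ℕ) (h0 : 0 ≤ y) (h1 : y ≤ 1) : (1 - y) ^ N ≤ binCDF N k y := by
  simpa [eval_bernsteinPolynomial] using eval_bernsteinPolynomial_le_binCDF N k.zero_le h0 h1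

lemma binCDF_pos (N k : ℕ) (h0 : 0 ≤ y) (h1 : y < 1) : 0 < binCDF N k y :=
  (pow_pos (sub_pos.2 h1) N).trans_le (pow_le_binCDF N k h0 h1.le)

lemma binCDF_one (hk : k < N) : binCDF N k 1 = 0 :=
  Finset.sum_eq_zero fun i hi => by
    rw [bernsteinPolynomial.eval_at_1, if_neg (by grind)]

lemma one_sub_binCDF (hk : k ≤ N) (y : ℝ) : 1 - binCDF N k y
    = ∑ i ∈ Finset.Ico (k + 1) (N + 1), (bernsteinPolynomial ℝ N i).eval y := by
  have hsum := congr_arg (Polynomial.eval y) (bernsteinPolynomial.sum ℝ N)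
  rw [Polynomial.eval_finsetSum, Polynomial.eval_one,
    ← Finset.sum_range_add_sum_Ico _ (Nat.succ_le_succ hk)] at hsum
  exact sub_eq_of_eq_add' hsum.symm

lemma sum_eval_bernsteinPolynomial_mul_le {s : Finset ℕ} (hs : s ⊆ Finset.range (N + 1))
    (h0 : 0 ≤ y) (h1 : y ≤ 1) (hl : 0 ≤ l) {c : ℝ} (hc : ∀ i ∈ s, c ≤ l ^ i) :
    (∑ i ∈ s, (bernsteinPolynomial ℝ N i).eval y) * c ≤ (1 - y + y * l) ^ N := by
  have hB := fun i => eval_bernsteinPolynomial_nonneg N i h0 h1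
  calc (∑ i ∈ s, (bernsteinPolynomial ℝ N i).eval y) * c
      ≤ ∑ i ∈ s, (bernsteinPolynomial ℝ N i).eval y * l ^ i := by
        rw [Finset.sum_mul]
        exact Finset.sum_le_sum fun i hi => mul_le_mul_of_nonneg_left (hc i hi) (hB i)
    _ ≤ ∑ i ∈ Finset.range (N + 1), (bernsteinPolynomial ℝ N i).eval y * l ^ i :=
        Finset.sum_le_sum_of_subset_of_nonneg hs fun i _ _ => mul_nonneg (hB i) (pow_nonneg hl i)
    _ = (1 - y + y * l) ^ N := by
        rw [add_comm (1 - y), add_pow]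
        exact Finset.sum_congr rfl fun i _ => by rw [eval_bernsteinPolynomial]; ring

lemma binCDF_mul_pow_le (hk : k ≤ N) (h0 : 0 ≤ y) (h1 : y ≤ 1) (hl0 : 0 ≤ l) (hl1 : l ≤ 1) :
    binCDF N k y * l ^ k ≤ (1 - y + y * l) ^ N :=
  sum_eval_bernsteinPolynomial_mul_le (Finset.range_subset_range.2 (Nat.succ_le_succ hk)) h0 h1 hl0
    fun _ hi => pow_le_pow_of_le_one hl0 hl1 (Finset.mem_range_succ_iff.1 hi)

lemma one_sub_binCDF_mul_pow_le (hk : k ≤ N) (h0 : 0 ≤ y) (h1 : y ≤ 1) (hl : 1 ≤ l) :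
    (1 - binCDF N k y) * l ^ (k + 1) ≤ (1 - y + y * l) ^ N := by
  rw [one_sub_binCDF hk]
  exact sum_eval_bernsteinPolynomial_mul_le
    (fun i hi => Finset.mem_range.2 (Finset.mem_Ico.1 hi).2) h0 h1 (zero_le_one.trans hl)
    fun i hi => pow_le_pow_right₀ hl (Finset.mem_Ico.1 hi).1

lemma derivative_sum_bernsteinPolynomial (n k : ℕ) :
    Polynomial.derivative (∑ i ∈ Finset.range (k + 1), bernsteinPolynomial ℝ (n + 1) i)
      = -((n + 1 : ℕ) * bernsteinPolynomial ℝ n k) := by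
  induction k with
  | zero =>
    rw [zero_add, Finset.sum_range_one, bernsteinPolynomial.derivative_zero, Nat.add_sub_cancel,
      neg_mul]
  | succ k ih =>
    rw [Finset.sum_range_succ, Polynomial.derivative_add, ih, bernsteinPolynomial.derivative_succ,
      Nat.add_sub_cancel]
    ring

lemma hasDerivAt_binCDF (n k : ℕ) (y : ℝ) :
    HasDerivAt (binCDF (n + 1) k) (-((n + 1) * (bernsteinPolynomial ℝ n k).eval y)) y := by
  have h := (∑ i ∈ Finset.range (k + 1), bernsteinPolynomial ℝ (n + 1) i).hasDerivAt y
  rw [derivative_sum_bernsteinPolynomial] at h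
  simpa [binCDF, Polynomial.eval_finsetSum] using! h

lemma integral_eval_bernsteinPolynomial (hk : k ≤ n) (y : ℝ) :
    ∫ x in y..1, (n + 1) * (bernsteinPolynomial ℝ n k).eval x = binCDF (n + 1) k y := by
  have hcont : Continuous fun x => -((n + 1) * (bernsteinPolynomial ℝ n k).eval x) := by fun_prop
  have h := intervalIntegral.integral_eq_sub_of_hasDerivAt (a := y) (b := 1)
    (fun x _ => hasDerivAt_binCDF n k x) (hcont.intervalIntegrable _ _)
  rwa [binCDF_one (Nat.lt_succ_of_le hk), intervalIntegral.integral_neg, zero_sub, neg_inj] at h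

lemma inv_beta_natCast (hk : k ≤ n) :
    1 / beta ((k : ℝ) + 1) ((n : ℝ) + 2 - (k + 1)) = (n + 1) * n.choose k := by
  have hnk : (n : ℝ) + 2 - (k + 1) = ((n - k : ℕ) : ℝ) + 1 := by
    rw [Nat.cast_sub hk]
    ring
  have hsum : (k : ℝ) + 1 + (((n - k : ℕ) : ℝ) + 1) = ((n + 1 : ℕ) : ℝ) + 1 := by
    rw [Nat.cast_sub hk]
    push_cast
    ring
  have hchoose : (n.choose k : ℝ) * k.factorial * (n - k).factorial = n.factorial := mod_cast
    Nat.choose_mul_factorial_mul_factorial hk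
  rw [hnk, beta, hsum, Real.Gamma_nat_eq_factorial, Real.Gamma_nat_eq_factorial,
    Real.Gamma_nat_eq_factorial, one_div_div, div_eq_iff (by positivity), Nat.factorial_succ]
  push_cast
  rw [← hchoose]
  ring

lemma betaPDF_natCast (hk : k ≤ n) (h0 : 0 < x) (h1 : x < 1) :
    betaPDF ((k : ℝ) + 1) ((n : ℝ) + 2 - (k + 1)) x
      = ENNReal.ofReal ((n + 1) * (bernsteinPolynomial ℝ n k).eval x) := by
  have hnk : (n : ℝ) + 2 - (k + 1) - 1 = ((n - k : ℕ) : ℝ) := by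
    rw [Nat.cast_sub hk]
    ring
  rw [betaPDF_of_pos_lt_one h0 h1, inv_beta_natCast hk, add_sub_cancel_right, hnk,
    Real.rpow_natCast, Real.rpow_natCast, eval_bernsteinPolynomial, mul_assoc, mul_assoc, mul_assoc]

lemma betaMeasure_inter_Ioi {s : Set ℝ} (hs : MeasurableSet s) (α β y : ℝ) :
    betaMeasure α β (s ∩ Set.Ioi y) = ∫⁻ x in s ∩ Set.Ioo y 1, betaPDF α β x := by
  have hsplit : s ∩ Set.Ioi y = s ∩ Set.Ioo y 1 ∪ s ∩ Set.Ioi y ∩ Set.Ici 1 := by grind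
  rw [betaMeasure, withDensity_apply _ (hs.inter measurableSet_Ioi)]
  refine le_antisymm ?_ (lintegral_mono_set (by grind))
  nth_rewrite 1 [hsplit]
  refine (lintegral_union_le _ _ _).trans_eq ?_
  rw [setLIntegral_eq_zero ((hs.inter measurableSet_Ioi).inter measurableSet_Ici)
    fun x hx => betaPDF_eq_zero_of_one_le hx.2, add_zero]

lemma betaMeasure_Ioi (hk : k ≤ n) (h0 : 0 ≤ y) (h1 : y ≤ 1) :
    betaMeasure ((k : ℝ) + 1) ((n : ℝ) + 2 - (k + 1)) (Set.Ioi y)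
      = ENNReal.ofReal (binCDF (n + 1) k y) := by
  have hcont : Continuous fun x => (n + 1) * (bernsteinPolynomial ℝ n k).eval x := by fun_prop
  rw [← Set.univ_inter (Set.Ioi y), betaMeasure_inter_Ioi .univ, Set.univ_inter,
    setLIntegral_congr_fun measurableSet_Ioo
      fun x hx => betaPDF_natCast hk (h0.trans_lt hx.1) hx.2,
    ← ofReal_integral_eq_lintegral_ofReal, ← integral_Ioc_eq_integral_Ioo,
    ← intervalIntegral.integral_of_le h1, integral_eval_bernsteinPolynomial hk]
  · exact hcont.integrableOn_Icc.mono_set Set.Ioo_subset_Icc_self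
  · refine ae_restrict_of_forall_mem measurableSet_Ioo fun x hx => ?_
    have := eval_bernsteinPolynomial_nonneg n k (h0.trans hx.1.le) hx.2.le
    simp only [Pi.zero_apply]
    positivity

end BinomialTail

/-! ### Exponential rates -/

section Rates

variable {n N k s : ℕ} {m p q t y z : ℝ}

/-- The relative entropy `d(p, q)` of Bernoulli laws as a real number; it agrees with `bernKL` away
from the infinite values of the latter. -/
def klReal (p q : ℝ) : ℝ := p * Real.log (p / q) + (1 - p) * Real.log ((1 - p) / (1 - q))

lemma klReal_eq_klFun (hq0 : q ≠ 0) (hq1 : q ≠ 1) : klReal p q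
    = q * klFun (p / q) + (1 - q) * klFun ((1 - p) / (1 - q)) := by
  have hq1' := sub_ne_zero.2 hq1.symm
  rw [klReal, klFun_apply, klFun_apply]
  field_simp
  ring

lemma klReal_nonneg (hp0 : 0 ≤ p) (hp1 : p ≤ 1) (hq0 : 0 < q) (hq1 : q < 1) : 0 ≤ klReal p q := by
  rw [klReal_eq_klFun hq0.ne' hq1.ne]
  have hp1' := sub_nonneg.2 hp1
  have hq1' := sub_pos.2 hq1
  have := klFun_nonneg (div_nonneg hp0 hq0.le)
  have := klFun_nonneg (div_nonneg hp1' hq1'.le)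
  positivity

lemma klReal_pos (hp0 : 0 ≤ p) (hp1 : p ≤ 1) (hq0 : 0 < q) (hq1 : q < 1) (hpq : p ≠ q) :
    0 < klReal p q := by
  refine (klReal_nonneg hp0 hp1 hq0 hq1).lt_of_ne' fun h => hpq ?_
  rw [klReal_eq_klFun hq0.ne' hq1.ne] at h
  have hfst := klFun_nonneg (div_nonneg hp0 hq0.le)
  have hsnd := klFun_nonneg (div_nonneg (sub_nonneg.2 hp1) (sub_pos.2 hq1).le)
  have hzero := ((add_eq_zero_iff_of_nonneg (mul_nonneg hq0.le hfst)
    (mul_nonneg (sub_pos.2 hq1).le hsnd)).1 h).1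
  rw [mul_eq_zero_iff_left hq0.ne', klFun_eq_zero_iff (div_nonneg hp0 hq0.le)]
    at hzero
  exact (div_eq_one_iff_eq hq0.ne').1 hzero

lemma binCDF_le_exp_klReal (hz : 0 < z) (hzy : z < y) (hy : y < 1) (hkz : (k : ℝ) ≤ z * N) :
    binCDF N k y ≤ Real.exp (-(N * klReal z y)) := by
  have hy0 : 0 < y := hz.trans hzy
  have hz1 : 0 < 1 - z := by linarith
  have hy1 : 0 < 1 - y := by linarith
  have hkN : k ≤ N := by
    have : (k : ℝ) ≤ N := hkz.trans (mul_le_of_le_one_left N.cast_nonneg (by linarith))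
    exact_mod_cast this
  set A := Real.log (z / y)
  set B := Real.log ((1 - z) / (1 - y))
  have hA : A ≤ 0 := Real.log_nonpos (by positivity) ((div_le_one hy0).2 hzy.le)
  have hB : 0 ≤ B := Real.log_nonneg ((one_le_div hy1).2 (by linarith))
  -- The optimal exponential tilt turns success probability `y` into `z`.
  have hmgf : 1 - y + y * Real.exp (A - B) = Real.exp (-B) := by
    rw [Real.exp_sub, Real.exp_neg, Real.exp_log (by positivity), Real.exp_log (by positivity)]
    field_simp
    ring
  have hchernoff := binCDF_mul_pow_le hkN hy0.le hy.le (Real.exp_pos (A - B)).le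
    (Real.exp_le_one_iff.2 (by linarith))
  rw [hmgf, ← Real.exp_nat_mul, ← Real.exp_nat_mul, ← le_div_iff₀ (Real.exp_pos _),
    ← Real.exp_sub] at hchernoff
  refine hchernoff.trans (Real.exp_le_exp.2 ?_)
  have := mul_le_mul_of_nonpos_right hkz (show A - B ≤ 0 by linarith)
  simp only [klReal]
  linarith

/-- A Gaussian rate at which binomial counts with success probability `p` concentrate away from the
frequency `t`; unlike the relative entropy, it stays in `(0, 1)` for all `p ≠ t`. -/
def rate (p t : ℝ) : ℝ := Real.exp (-(t - p) ^ 2 / 4)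

lemma rate_pos (p t : ℝ) : 0 < rate p t := Real.exp_pos _

lemma rate_lt_one (h : p ≠ t) : rate p t < 1 := by
  rw [rate, Real.exp_lt_one_iff]
  have := sq_pos_of_ne_zero (sub_ne_zero.2 h.symm)
  linarith

lemma rate_le_one (p t : ℝ) : rate p t ≤ 1 := by
  rw [rate, Real.exp_le_one_iff]
  have := sq_nonneg (t - p)
  linarith

lemma mgf_bernoulli_le_rate (hp0 : 0 ≤ p) (hp1 : p ≤ 1) (ht0 : 0 ≤ t) (ht1 : t ≤ 1) :
    1 - p + p * Real.exp ((t - p) / 2) ≤ Real.exp (t * ((t - p) / 2)) * rate p t := by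
  have hexp := (abs_le.1 (Real.abs_exp_sub_one_sub_id_le
    (show |(t - p) / 2| ≤ 1 by rw [abs_le]; constructor <;> linarith))).2
  rw [rate, ← Real.exp_add]
  have := Real.add_one_le_exp (t * ((t - p) / 2) + -(t - p) ^ 2 / 4)
  have := mul_le_mul_of_nonneg_left hexp hp0
  nlinarith [mul_nonneg (sub_nonneg.2 hp1) (sq_nonneg (t - p))]

lemma mgf_bernoulli_pow_le_rate (hp0 : 0 ≤ p) (hp1 : p ≤ 1) (ht0 : 0 ≤ t) (ht1 : t ≤ 1) (N : ℕ) :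
    (1 - p + p * Real.exp ((t - p) / 2)) ^ N
      ≤ Real.exp (t * N * ((t - p) / 2)) * rate p t ^ N := by
  have := sub_nonneg.2 hp1
  calc (1 - p + p * Real.exp ((t - p) / 2)) ^ N
      ≤ (Real.exp (t * ((t - p) / 2)) * rate p t) ^ N :=
        pow_le_pow_left₀ (by positivity) (mgf_bernoulli_le_rate hp0 hp1 ht0 ht1) N
    _ = Real.exp (t * N * ((t - p) / 2)) * rate p t ^ N := by
        rw [mul_pow, ← Real.exp_nat_mul]
        ring_nf

lemma binCDF_le_rate_pow (ht : 0 ≤ t) (hty : t ≤ y) (hy : y ≤ 1) (hkt : (k : ℝ) ≤ t * N) :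
    binCDF N k y ≤ rate y t ^ N := by
  have hkN : k ≤ N := by
    have : (k : ℝ) ≤ N := hkt.trans (mul_le_of_le_one_left N.cast_nonneg (hty.trans hy))
    exact_mod_cast this
  have hx : (t - y) / 2 ≤ 0 := by linarith
  have hchernoff := (binCDF_mul_pow_le hkN (ht.trans hty) hy (Real.exp_pos _).le
    (Real.exp_le_one_iff.2 hx)).trans
      (mgf_bernoulli_pow_le_rate (ht.trans hty) hy ht (hty.trans hy) N)
  have hexp : Real.exp (t * N * ((t - y) / 2)) ≤ Real.exp ((t - y) / 2) ^ k := by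
    rw [← Real.exp_nat_mul]
    exact Real.exp_le_exp.2 (mul_le_mul_of_nonpos_right hkt hx)
  refine le_of_mul_le_mul_right (hchernoff.trans ?_) (pow_pos (Real.exp_pos ((t - y) / 2)) k)
  rw [mul_comm]
  exact mul_le_mul_of_nonneg_left hexp (pow_pos (rate_pos y t) N).le

lemma one_sub_binCDF_le_rate_pow (hk : k ≤ n) (h0 : 0 ≤ y) (hyt : y ≤ t) (ht : t ≤ 1)
    (hkt : t * n ≤ k + 1) : 1 - binCDF (n + 1) k y ≤ 3 * rate y t ^ n := by
  have hx : 0 ≤ (t - y) / 2 := by linarith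
  have hchernoff := (one_sub_binCDF_mul_pow_le (Nat.le_succ_of_le hk) h0 (hyt.trans ht)
    (Real.one_le_exp hx)).trans
      (mgf_bernoulli_pow_le_rate h0 (hyt.trans ht) (h0.trans hyt) ht (n + 1))
  have hexp : Real.exp (t * (n + 1 : ℕ) * ((t - y) / 2))
      ≤ 3 * Real.exp ((t - y) / 2) ^ (k + 1) := by
    calc Real.exp (t * (n + 1 : ℕ) * ((t - y) / 2))
        ≤ Real.exp (1 + (k + 1 : ℕ) * ((t - y) / 2)) := by
          refine Real.exp_le_exp.2 ?_
          push_cast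
          nlinarith
      _ ≤ 3 * Real.exp ((t - y) / 2) ^ (k + 1) := by
          rw [Real.exp_add, Real.exp_nat_mul]
          gcongr
          exact Real.exp_one_lt_three.le
  refine le_of_mul_le_mul_right (hchernoff.trans ?_) (pow_pos (Real.exp_pos ((t - y) / 2)) (k + 1))
  calc Real.exp (t * (n + 1 : ℕ) * ((t - y) / 2)) * rate y t ^ (n + 1)
      ≤ 3 * Real.exp ((t - y) / 2) ^ (k + 1) * rate y t ^ n :=
        mul_le_mul hexp (pow_le_pow_of_le_one (rate_pos y t).le (rate_le_one y t) n.le_succ)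
          (pow_pos (rate_pos y t) _).le (by positivity)
    _ = 3 * rate y t ^ n * Real.exp ((t - y) / 2) ^ (k + 1) := by ring

/-- The exponential weight of `s` successes in `n` trials, relative to the frequency `t`. For trials
with success probability `p` it is a supermartingale, even after multiplication by
`(rate p t)⁻¹ ^ n`. -/
def tilt (p t : ℝ) (n s : ℕ) : ℝ := Real.exp ((t - p) / 2 * (s - t * n))

lemma tilt_pos (p t : ℝ) (n s : ℕ) : 0 < tilt p t n s := Real.exp_pos _

lemma tilt_zero (p t : ℝ) : tilt p t 0 0 = 1 := by simp [tilt]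

lemma trial_tilt_le (hp0 : 0 ≤ p) (hp1 : p ≤ 1) (ht0 : 0 ≤ t) (ht1 : t ≤ 1) (n s : ℕ) :
    trial p (tilt p t) n s ≤ rate p t * tilt p t n s := by
  have hfail : tilt p t (n + 1) s = tilt p t n s * Real.exp (-(t * ((t - p) / 2))) := by
    rw [tilt, tilt, ← Real.exp_add]
    push_cast
    ring_nf
  have hsucc : tilt p t (n + 1) (s + 1)
      = tilt p t n s * Real.exp (-(t * ((t - p) / 2))) * Real.exp ((t - p) / 2) := by
    rw [tilt, tilt, ← Real.exp_add, ← Real.exp_add]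
    push_cast
    ring_nf
  calc trial p (tilt p t) n s
      = tilt p t n s * Real.exp (-(t * ((t - p) / 2)))
          * (1 - p + p * Real.exp ((t - p) / 2)) := by
        rw [trial, hsucc, hfail]
        ring
    _ ≤ tilt p t n s * Real.exp (-(t * ((t - p) / 2)))
          * (Real.exp (t * ((t - p) / 2)) * rate p t) :=
        mul_le_mul_of_nonneg_left (mgf_bernoulli_le_rate hp0 hp1 ht0 ht1)
          (mul_pos (tilt_pos p t n s) (Real.exp_pos _)).le
    _ = rate p t * tilt p t n s := by
        rw [Real.exp_neg]
        field_simp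

lemma one_le_tilt_of_le (h : t ≤ p) (hs : (s : ℝ) ≤ t * n) : 1 ≤ tilt p t n s :=
  Real.one_le_exp (mul_nonneg_of_nonpos_of_nonpos (by linarith) (by linarith))

lemma one_le_tilt_of_ge (h : p ≤ t) (hs : t * n ≤ (s : ℝ)) : 1 ≤ tilt p t n s :=
  Real.one_le_exp (mul_nonneg (by linarith) (by linarith))

lemma rpow_mul_rpow_lt_one (hy0 : 0 < y) (hy1 : y < 1) (hym : y ≠ m) (hm0 : 0 ≤ m)
    (hm1 : m ≤ 1) : (m / y) ^ y * ((1 - m) / (1 - y)) ^ (1 - y) < 1 := by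
  have hy1' := sub_pos.2 hy1
  have hne : m / y ≠ (1 - m) / (1 - y) := by
    rw [Ne, div_eq_div_iff hy0.ne' hy1'.ne']
    exact fun h => hym (by linarith)
  have h := (Real.geom_mean_lt_arith_mean_weighted_iff_of_pos Finset.univ ![y, 1 - y]
    ![m / y, (1 - m) / (1 - y)] (by simp [Fin.forall_fin_two, hy0, hy1])
    (by simp [Fin.sum_univ_two]) (by
      simpa [Fin.forall_fin_two] using
        And.intro (div_nonneg hm0 hy0.le) (div_nonneg (sub_nonneg.2 hm1) hy1'.le))).2
    ⟨0, Finset.mem_univ _, 1, Finset.mem_univ _, hne⟩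
  simpa [Fin.prod_univ_two, Fin.sum_univ_two, mul_div_cancel₀, hy0.ne', hy1'.ne'] using h

lemma exists_likelihood_ratio_le (hy0 : 0 < y) (hym : y < m) (hm : m ≤ 1) :
    ∃ t ρ : ℝ, y < t ∧ t < m ∧ 0 ≤ ρ ∧ ρ < 1 ∧ ∀ n s : ℕ, s ≤ n → (s : ℝ) ≤ t * n →
      (m / y) ^ s * ((1 - m) / (1 - y)) ^ (n - s) ≤ ρ ^ n := by
  have hy1 : 0 < 1 - y := by linarith
  set v := m / y
  set u := (1 - m) / (1 - y)
  have hv : 1 ≤ v := (one_le_div hy0).2 hym.le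
  have hu0 : 0 ≤ u := div_nonneg (by linarith) hy1.le
  have hu1 : u ≤ 1 := (div_le_one hy1).2 (by linarith)
  have hcont : ContinuousAt (fun t : ℝ => v ^ t * u ^ (1 - t)) y :=
    (Real.continuousAt_const_rpow' hy0.ne').mul
      (ContinuousAt.comp (f := fun t : ℝ => 1 - t) (Real.continuousAt_const_rpow' hy1.ne')
        (by fun_prop))
  obtain ⟨t, hlt, hyt, htm⟩ := (((hcont.eventually_lt_const
    (rpow_mul_rpow_lt_one hy0 (hym.trans_le hm) hym.ne (hy0.trans hym).le hm)).filter_mono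
      nhdsWithin_le_nhds).and (Ioo_mem_nhdsGT hym)).exists
  refine ⟨t, v ^ t * u ^ (1 - t), hyt, htm, by positivity, hlt, fun n s hsn hs => ?_⟩
  rw [mul_pow, ← Real.rpow_mul_natCast (by positivity), ← Real.rpow_mul_natCast hu0,
    ← Real.rpow_natCast, ← Real.rpow_natCast u]
  have hexp : (1 - t) * n ≤ (n - s : ℕ) := by
    rw [Nat.cast_sub hsn]
    linarith
  exact mul_le_mul (Real.rpow_le_rpow_of_exponent_le hv hs)
    (Real.rpow_le_rpow_of_exponent_ge' hu0 hu1 (mul_nonneg (by linarith) n.cast_nonneg) hexp)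
    (by positivity) (by positivity)

end Rates

/-! ### The posterior indices -/

section Posterior

variable {K : ℕ} {ε y z : ℝ} {h : History K} {a : Fin K}

/-- The success count `⌊S_a / (1 - ε)⌋` that enters the Beta posterior of an arm: the indices live
on `[0, 1 - ε]`, so frequencies are measured relative to `1 - ε`. -/
def scaledSuccesses (ε : ℝ) (h : History K) (a : Fin K) : ℕ := ⌊(successes h a : ℝ) / (1 - ε)⌋₊

lemma scaledSuccesses_le_pulls (hmean : empMean h a ≤ 1 - ε) :
    scaledSuccesses ε h a ≤ pulls h a := by
  have hpos := betaParam_pos ε h a hmean.not_gt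
  unfold betaParam alphaParam at hpos
  have hlt : (scaledSuccesses ε h a : ℝ) < (pulls h a + 1 : ℕ) := by
    push_cast [scaledSuccesses]
    linarith
  exact Nat.lt_succ_iff.1 (Nat.cast_lt.1 hlt)

lemma successes_le_scaledSuccesses (hε0 : 0 ≤ ε) (hε1 : ε < 1) (h : History K) (a : Fin K) :
    successes h a ≤ scaledSuccesses ε h a :=
  Nat.le_floor (le_div_self (Nat.cast_nonneg _) (by linarith) (by linarith))

lemma scaledSuccesses_le_of_successes_le (hε : ε < 1) (hs : (successes h a : ℝ) ≤ z * pulls h a) :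
    (scaledSuccesses ε h a : ℝ) ≤ z / (1 - ε) * pulls h a := by
  have : 0 < 1 - ε := by linarith
  refine (Nat.floor_le (by positivity)).trans ?_
  rw [div_mul_eq_mul_div]
  gcongr

lemma le_scaledSuccesses_of_le_successes (hε : ε < 1) (hs : z * pulls h a ≤ successes h a) :
    z / (1 - ε) * pulls h a ≤ scaledSuccesses ε h a + 1 := by
  have : 0 < 1 - ε := by linarith
  refine le_trans ?_ (Nat.lt_floor_add_one ((successes h a : ℝ) / (1 - ε))).le
  rw [div_mul_eq_mul_div]
  gcongr

lemma empMean_le_of_successes_le (hz : 0 ≤ z) (hs : (successes h a : ℝ) ≤ z * pulls h a) :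
    empMean h a ≤ z :=
  div_le_of_le_mul₀ (Nat.cast_nonneg _) hz hs

lemma successes_le_of_empMean_le (hmean : empMean h a ≤ z) :
    (successes h a : ℝ) ≤ z * pulls h a := by
  rcases Nat.eq_zero_or_pos (pulls h a) with h0 | h0
  · have : successes h a = 0 := Nat.le_zero.1 (h0 ▸ successes_le_pulls h a)
    simp [this, h0]
  · exact (div_le_iff₀ (Nat.cast_pos.2 h0)).1 hmean

lemma posterior_inter_Ioi (hε : ε < 1) (hmean : empMean h a ≤ 1 - ε) (y : ℝ) {s : Set ℝ}
    (hs : MeasurableSet s) :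
    posterior ε h a (s ∩ Set.Ioi y) = betaMeasure ((scaledSuccesses ε h a : ℝ) + 1)
      ((pulls h a : ℝ) + 2 - (scaledSuccesses ε h a + 1))
        ((fun x => (1 - ε) * x) ⁻¹' s ∩ Set.Ioi (y / (1 - ε))) := by
  have hpre : (fun x => (1 - ε) * x) ⁻¹' Set.Ioi y = Set.Ioi (y / (1 - ε)) :=
    Set.ext fun x => (div_lt_iff₀' (sub_pos.2 hε)).symm
  rw [posterior, if_neg hmean.not_gt,
    Measure.map_apply (by fun_prop) (hs.inter measurableSet_Ioi), Set.preimage_inter, hpre]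
  rfl

lemma posterior_real_Ioi (hε : ε < 1) (hmean : empMean h a ≤ 1 - ε) (hy0 : 0 ≤ y)
    (hy : y ≤ 1 - ε) :
    (posterior ε h a).real (Set.Ioi y)
      = binCDF (pulls h a + 1) (scaledSuccesses ε h a) (y / (1 - ε)) := by
  have h0 : 0 ≤ y / (1 - ε) := div_nonneg hy0 (by linarith)
  have h1 : y / (1 - ε) ≤ 1 := (div_le_one (by linarith)).2 hy
  have hbeta := posterior_inter_Ioi hε hmean y MeasurableSet.univ
  rw [Set.preimage_univ, Set.univ_inter, Set.univ_inter,
    betaMeasure_Ioi (scaledSuccesses_le_pulls hmean) h0 h1] at hbeta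
  rw [Measure.real, hbeta, ENNReal.toReal_ofReal (binCDF_nonneg _ _ h0 h1)]

lemma posterior_real_Ioi_of_lt (hmean : 1 - ε < empMean h a) (hy : y ≤ 1 - ε) :
    (posterior ε h a).real (Set.Ioi y) = 1 := by
  rw [posterior, if_pos hmean, Measure.real,
    Measure.dirac_apply_of_mem (show empMean h a ∈ Set.Ioi y from hy.trans_lt hmean),
    ENNReal.toReal_one]

lemma posterior_real_Ioi_pos (hε : ε < 1) (h : History K) (a : Fin K) (hy0 : 0 ≤ y)
    (hy : y < 1 - ε) : 0 < (posterior ε h a).real (Set.Ioi y) := by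
  rcases le_or_gt (empMean h a) (1 - ε) with hmean | hmean
  · rw [posterior_real_Ioi hε hmean hy0 hy.le]
    exact binCDF_pos _ _ (div_nonneg hy0 (by linarith)) ((div_lt_one (by linarith)).2 hy)
  · rw [posterior_real_Ioi_of_lt hmean hy.le]
    exact one_pos

lemma posterior_real_Ioi_le_exp (hε : ε < 1) (hz : 0 < z) (hzy : z < y) (hy : y < 1 - ε)
    (hs : (successes h a : ℝ) ≤ z * pulls h a) :
    (posterior ε h a).real (Set.Ioi y)
      ≤ Real.exp (-(pulls h a * klReal (z / (1 - ε)) (y / (1 - ε)))) := by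
  have hr : 0 < 1 - ε := by linarith
  have hz' : 0 < z / (1 - ε) := div_pos hz hr
  have hzy' : z / (1 - ε) < y / (1 - ε) := div_lt_div_of_pos_right hzy hr
  have hy' : y / (1 - ε) < 1 := (div_lt_one hr).2 hy
  have hmean : empMean h a ≤ 1 - ε := (empMean_le_of_successes_le hz.le hs).trans (by linarith)
  have hk := scaledSuccesses_le_of_successes_le hε hs
  have hkl := klReal_pos hz'.le (hzy'.trans hy').le (hz'.trans hzy') hy' hzy'.ne
  rw [posterior_real_Ioi hε hmean (by linarith) hy.le]
  refine (binCDF_le_exp_klReal hz' hzy' hy' ?_).trans (Real.exp_le_exp.2 ?_) <;>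
  · push_cast
    linarith

lemma lowOdds_posterior_of_lt (hmean : 1 - ε < empMean h a) (hy : y ≤ 1 - ε) :
    lowOdds (posterior ε h a) y = 0 := by
  rw [lowOdds, ← Set.compl_Ioi, probReal_compl_eq_one_sub measurableSet_Ioi,
    posterior_real_Ioi_of_lt hmean hy, sub_self, zero_div]

lemma lowOdds_posterior (hε : ε < 1) (hmean : empMean h a ≤ 1 - ε) (hy0 : 0 ≤ y)
    (hy : y ≤ 1 - ε) :
    lowOdds (posterior ε h a) y
      = (1 - binCDF (pulls h a + 1) (scaledSuccesses ε h a) (y / (1 - ε)))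
        / binCDF (pulls h a + 1) (scaledSuccesses ε h a) (y / (1 - ε)) := by
  rw [lowOdds, ← Set.compl_Ioi, probReal_compl_eq_one_sub measurableSet_Ioi,
    posterior_real_Ioi hε hmean hy0 hy]

lemma lowOdds_posterior_le_inv (hε : ε < 1) (hy0 : 0 ≤ y) (hy : y ≤ 1 - ε) {b : ℝ} (hb : 0 < b)
    (hle : b ≤ binCDF (pulls h a + 1) (scaledSuccesses ε h a) (y / (1 - ε))) :
    lowOdds (posterior ε h a) y ≤ b⁻¹ := by
  rcases le_or_gt (empMean h a) (1 - ε) with hmean | hmean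
  · rw [lowOdds_posterior hε hmean hy0 hy, ← one_div]
    exact div_le_div₀ zero_le_one (by linarith) hb hle
  · rw [lowOdds_posterior_of_lt hmean hy]
    exact inv_nonneg.2 hb.le

lemma lowOdds_posterior_le_inv_pow (hε : ε < 1) (hy0 : 0 ≤ y) (hy : y < 1 - ε) (h : History K)
    (a : Fin K) :
    lowOdds (posterior ε h a) y ≤ ((1 - y / (1 - ε)) ^ (pulls h a + 1))⁻¹ := by
  have h1 : y / (1 - ε) < 1 := (div_lt_one (by linarith)).2 hy
  exact lowOdds_posterior_le_inv hε hy0 hy.le (pow_pos (sub_pos.2 h1) _)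
    (pow_le_binCDF _ _ (div_nonneg hy0 (by linarith)) h1.le)

lemma le_mul_pow_of_le_of_le {c ρ x : ℝ} {D : ℕ → ℝ} {m n : ℕ} (hc : 0 ≤ c) (hρ0 : 0 < ρ)
    (hρ1 : ρ ≤ 1) (hD : Monotone D) (hD0 : 0 ≤ D 0) (hlarge : m ≤ n → x ≤ c * ρ ^ n)
    (hx : x ≤ D n) : x ≤ (c + D m / ρ ^ m) * ρ ^ n := by
  have hDm : 0 ≤ D m := hD0.trans (hD m.zero_le)
  rw [add_mul]
  rcases le_or_gt m n with hmn | hnm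
  · exact (hlarge hmn).trans (le_add_of_nonneg_right (by positivity))
  · calc x ≤ D m := hx.trans (hD hnm.le)
      _ ≤ D m / ρ ^ m * ρ ^ n := by
        rw [div_mul_eq_mul_div, le_div_iff₀ (pow_pos hρ0 m)]
        exact mul_le_mul_of_nonneg_left (pow_le_pow_of_le_one hρ0.le hρ1 hnm.le) hDm
      _ ≤ c * ρ ^ n + D m / ρ ^ m * ρ ^ n := le_add_of_nonneg_left (by positivity)

lemma monotone_inv_one_sub_pow {x : ℝ} (hx0 : 0 ≤ x) (hx1 : x < 1) :
    Monotone fun n : ℕ => ((1 - x) ^ (n + 1))⁻¹ := fun m n hmn =>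
  inv_anti₀ (pow_pos (sub_pos.2 hx1) _)
    (pow_le_pow_of_le_one (sub_pos.2 hx1).le (by linarith) (by omega))

lemma lowOdds_posterior_le_rate_pow (hε : ε < 1) (hy0 : 0 ≤ y) (hy : y < 1 - ε) {t : ℝ}
    (hyt : y / (1 - ε) < t) (ht : t ≤ 1) (hs : t * pulls h a ≤ scaledSuccesses ε h a + 1)
    (hsmall : rate (y / (1 - ε)) t ^ pulls h a ≤ 1 / 6) :
    lowOdds (posterior ε h a) y ≤ 6 * rate (y / (1 - ε)) t ^ pulls h a := by
  have h0 : 0 ≤ y / (1 - ε) := div_nonneg hy0 (by linarith)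
  have hρ := pow_pos (rate_pos (y / (1 - ε)) t) (pulls h a)
  rcases le_or_gt (empMean h a) (1 - ε) with hmean | hmean
  · have htail := one_sub_binCDF_le_rate_pow (scaledSuccesses_le_pulls hmean) h0 hyt.le ht hs
    rw [lowOdds_posterior hε hmean hy0 hy.le,
      div_le_iff₀ (binCDF_pos _ _ h0 ((div_lt_one (by linarith)).2 hy))]
    nlinarith
  · rw [lowOdds_posterior_of_lt hmean hy.le]
    positivity

lemma exists_lowOdds_posterior_le_rate_pow (hε : ε < 1) (hy0 : 0 ≤ y) (hy : y < 1 - ε) {t : ℝ}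
    (hyt : y / (1 - ε) < t) (ht : t ≤ 1) :
    ∃ C : ℝ, 0 ≤ C ∧ ∀ {K : ℕ} (h : History K) (a : Fin K),
      t * pulls h a ≤ scaledSuccesses ε h a + 1 →
        lowOdds (posterior ε h a) y ≤ C * rate (y / (1 - ε)) t ^ pulls h a := by
  have h0 : 0 ≤ y / (1 - ε) := div_nonneg hy0 (by linarith)
  have h1 : 0 < 1 - y / (1 - ε) := by linarith
  have hρ0 := rate_pos (y / (1 - ε)) t
  obtain ⟨N, hN⟩ := exists_pow_lt_of_lt_one (show (0 : ℝ) < 1 / 6 by norm_num)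
    (rate_lt_one hyt.ne)
  refine ⟨6 + ((1 - y / (1 - ε)) ^ (N + 1))⁻¹ / rate (y / (1 - ε)) t ^ N, by positivity,
    fun h a hs => ?_⟩
  refine le_mul_pow_of_le_of_le (by norm_num) hρ0 (rate_le_one _ _)
    (monotone_inv_one_sub_pow h0 (hyt.trans_le ht)) (by positivity) (fun hn => ?_)
    (lowOdds_posterior_le_inv_pow hε hy0 hy h a)
  exact lowOdds_posterior_le_rate_pow hε hy0 hy hyt ht hs
    ((pow_le_pow_of_le_one hρ0.le (rate_le_one _ _) hn).trans hN.le)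

lemma exists_lowOdds_posterior_le_of_not_underestimated (hε : ε < 1) (hy0 : 0 ≤ y) {w : ℝ}
    (hyw : y < w) (hw : w ≤ 1 - ε) (m : ℕ) :
    ∃ C ρ : ℝ, 0 ≤ C ∧ 0 ≤ ρ ∧ ρ < 1 ∧ ∀ {K : ℕ} (h : History K) (a : Fin K),
      ¬ (m ≤ pulls h a ∧ (successes h a : ℝ) ≤ w * pulls h a) →
        lowOdds (posterior ε h a) y ≤ C * ρ ^ pulls h a := by
  have hr : 0 < 1 - ε := by linarith
  have hyw' : y / (1 - ε) < w / (1 - ε) := div_lt_div_of_pos_right hyw hr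
  have hw' : w / (1 - ε) ≤ 1 := (div_le_one hr).2 hw
  have h0 : 0 ≤ y / (1 - ε) := by positivity
  have h1 : 0 < 1 - y / (1 - ε) := by linarith
  obtain ⟨C, hC0, hC⟩ :=
    exists_lowOdds_posterior_le_rate_pow hε hy0 (hyw.trans_le hw) hyw' hw'
  have hρ0 := rate_pos (y / (1 - ε)) (w / (1 - ε))
  refine ⟨C + ((1 - y / (1 - ε)) ^ (m + 1))⁻¹ / rate (y / (1 - ε)) (w / (1 - ε)) ^ m, _,
    by positivity, hρ0.le, rate_lt_one hyw'.ne, fun h a hnot => ?_⟩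
  refine le_mul_pow_of_le_of_le hC0 hρ0 (rate_le_one _ _)
    (monotone_inv_one_sub_pow h0 (by linarith)) (by positivity) (fun hm => hC h a ?_)
    (lowOdds_posterior_le_inv_pow hε hy0 (hyw.trans_le hw) h a)
  exact le_scaledSuccesses_of_le_successes hε (not_le.1 fun hs => hnot ⟨hm, hs⟩).le

end Posterior

/-! ### Underestimation of an optimal arm -/

section Underestimation

variable {p t x ρ : ℝ}

/-- The inverse of the probability of `s` successes in `n + 1` trials, cut off at the frequency `t`.
It bounds the odds that the posterior index of an arm with `s` successes in `n` plays is low. -/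
def invBernstein (x t : ℝ) (n s : ℕ) : ℝ :=
  open Classical in
  if s ≤ n ∧ (s : ℝ) ≤ t * n then ((bernsteinPolynomial ℝ (n + 1) s).eval x)⁻¹ else 0

lemma invBernstein_nonneg (hx0 : 0 ≤ x) (hx1 : x ≤ 1) (t : ℝ) (n s : ℕ) :
    0 ≤ invBernstein x t n s := by
  unfold invBernstein
  split_ifs
  · exact inv_nonneg.2 (eval_bernsteinPolynomial_nonneg _ _ hx0 hx1)
  · exact le_rfl

lemma choose_mul_div_eval_bernsteinPolynomial_le (hp0 : 0 ≤ p) (hp1 : p ≤ 1) (hx0 : 0 < x)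
    (hx1 : x < 1) (i k : ℕ) :
    ((i + k).choose i : ℝ) * (p ^ i * (1 - p) ^ k
        * ((bernsteinPolynomial ℝ (i + k + 1) i).eval x)⁻¹)
      ≤ (1 - x)⁻¹ * ((p / x) ^ i * ((1 - p) / (1 - x)) ^ k) := by
  have := sub_nonneg.2 hp1
  have hx1' := sub_pos.2 hx1
  have hchoose : ((i + k).choose i : ℝ) ≤ (i + k + 1).choose i := by
    exact_mod_cast Nat.choose_le_choose i (i + k).le_succ
  have hchoose_pos : (0 : ℝ) < (i + k + 1).choose i := by
    exact_mod_cast Nat.choose_pos (by omega)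
  have hsplit : ((i + k).choose i : ℝ) * (p ^ i * (1 - p) ^ k
        * ((bernsteinPolynomial ℝ (i + k + 1) i).eval x)⁻¹)
      = (i + k).choose i / (i + k + 1).choose i
        * ((1 - x)⁻¹ * ((p / x) ^ i * ((1 - p) / (1 - x)) ^ k)) := by
    rw [eval_bernsteinPolynomial, show i + k + 1 - i = k + 1 by omega, pow_succ, div_pow, div_pow]
    field_simp
  rw [hsplit]
  exact mul_le_of_le_one_left (by positivity) ((div_le_one hchoose_pos).2 hchoose)

lemma iterate_trial_invBernstein_le (hp0 : 0 ≤ p) (hp1 : p ≤ 1) (hx0 : 0 < x) (hx1 : x < 1)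
    (hρ : 0 ≤ ρ) (hratio : ∀ n s : ℕ, s ≤ n → (s : ℝ) ≤ t * n →
      (p / x) ^ s * ((1 - p) / (1 - x)) ^ (n - s) ≤ ρ ^ n) (j : ℕ) :
    (trial p)^[j] (invBernstein x t) 0 0 ≤ (1 - x)⁻¹ * ((j + 1) * ρ ^ j) := by
  have := sub_pos.2 hx1
  rw [iterate_trial]
  refine (Finset.sum_le_card_nsmul _ _ ((1 - x)⁻¹ * ρ ^ j) ?_).trans_eq ?_
  · rintro ⟨i, k⟩ hik
    obtain rfl := Finset.HasAntidiagonal.mem_antidiagonal.1 hik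
    simp only [zero_add, invBernstein]
    split_ifs with hcut
    · refine (choose_mul_div_eval_bernsteinPolynomial_le hp0 hp1 hx0 hx1 i k).trans
        (mul_le_mul_of_nonneg_left ?_ (by positivity))
      simpa using hratio (i + k) i hcut.1 hcut.2
    · rw [mul_zero, mul_zero]
      positivity
  · rw [Finset.Nat.card_antidiagonal, nsmul_eq_mul]
    push_cast
    ring

lemma exists_sum_mul_geometric_le (h0 : 0 ≤ ρ) (h1 : ρ < 1) :
    ∃ M : ℝ, ∀ T : ℕ, ∑ j ∈ Finset.range T, ((j : ℝ) + 1) * ρ ^ j ≤ M := by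
  have hlin := summable_pow_mul_geometric_of_norm_lt_one 1
    (show ‖ρ‖ < 1 by rwa [Real.norm_of_nonneg h0])
  have hs : Summable fun j : ℕ => ((j : ℝ) + 1) * ρ ^ j :=
    (hlin.add (summable_geometric_of_lt_one h0 h1)).congr fun j => by ring
  exact ⟨_, fun T => hs.sum_le_tsum _ fun j _ => by positivity⟩

variable {K : ℕ} {ε y : ℝ}

lemma lowOdds_posterior_le_invBernstein (hε0 : 0 ≤ ε) (hε1 : ε < 1) (hy0 : 0 < y) (hy : y < 1 - ε)
    {h : History K} {a : Fin K} (hs : (successes h a : ℝ) ≤ t * pulls h a) :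
    lowOdds (posterior ε h a) y
      ≤ invBernstein (y / (1 - ε)) t (pulls h a) (successes h a) := by
  have h0 : 0 < y / (1 - ε) := div_pos hy0 (by linarith)
  have h1 : y / (1 - ε) < 1 := (div_lt_one (by linarith)).2 hy
  have hle := successes_le_pulls h a
  have hpos : 0 < (bernsteinPolynomial ℝ (pulls h a + 1) (successes h a)).eval (y / (1 - ε)) := by
    have := sub_pos.2 h1
    have : 0 < (pulls h a + 1).choose (successes h a) := Nat.choose_pos (by omega)
    rw [eval_bernsteinPolynomial]
    positivity
  rw [invBernstein, if_pos ⟨hle, hs⟩]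
  exact lowOdds_posterior_le_inv hε1 hy0.le hy.le hpos
    (eval_bernsteinPolynomial_le_binCDF _ (successes_le_scaledSuccesses hε0 hε1 h a) h0.le h1.le)

lemma exists_lowOdds_posterior_le_add_invBernstein (hε0 : 0 ≤ ε) (hε1 : ε < 1) (hy0 : 0 < y)
    (hy : y < 1 - ε) (hyt : y / (1 - ε) < t) (ht : t ≤ 1) :
    ∃ C : ℝ, 0 ≤ C ∧ ∀ (h : History K) (a : Fin K), lowOdds (posterior ε h a) y
      ≤ C * rate (y / (1 - ε)) t ^ pulls h a
        + invBernstein (y / (1 - ε)) t (pulls h a) (successes h a) := by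
  have h0 : 0 ≤ y / (1 - ε) := div_nonneg hy0.le (by linarith)
  obtain ⟨C, hC0, hC⟩ := exists_lowOdds_posterior_le_rate_pow hε1 hy0.le hy hyt ht
  refine ⟨C, hC0, fun h a => ?_⟩
  rcases le_or_gt (successes h a : ℝ) (t * pulls h a) with hs | hs
  · exact le_add_of_nonneg_of_le (mul_nonneg hC0 (pow_pos (rate_pos _ t) _).le)
      (lowOdds_posterior_le_invBernstein hε0 hε1 hy0 hy hs)
  · have : (successes h a : ℝ) ≤ scaledSuccesses ε h a :=
      Nat.cast_le.2 (successes_le_scaledSuccesses hε0 hε1 h a)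
    exact le_add_of_le_of_nonneg (hC h a (by linarith))
      (invBernstein_nonneg h0 (hyt.le.trans ht) t _ _)

lemma exists_expectedSum_play_mul_lowOdds_le [NeZero K] (p : Fin K → unitInterval) (hε0 : 0 ≤ ε)
    (hε1 : ε < 1) (o : Fin K) (hy0 : 0 < y) (hy : y / (1 - ε) < p o) :
    ∃ M : ℝ, ∀ T, expectedSum (playLaw ε) p T
      (fun h => playProb (playLaw ε) h o * lowOdds (posterior ε h o) y) ≤ M := by
  set x := y / (1 - ε)
  have hx0 : 0 < x := div_pos hy0 (by linarith)
  have hx1 : x < 1 := hy.trans_le (p o).2.2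
  have hyε : y < 1 - ε := (div_lt_one (by linarith)).1 hx1
  obtain ⟨t, ρ, hxt, htp, hρ0, hρ1, hratio⟩ := exists_likelihood_ratio_le hx0 hy (p o).2.2
  obtain ⟨C, hC0, hC⟩ := exists_lowOdds_posterior_le_add_invBernstein (K := K) hε0 hε1 hy0 hyε hxt
    (htp.le.trans (p o).2.2)
  obtain ⟨M, hM⟩ := exists_sum_mul_geometric_le hρ0 hρ1
  refine ⟨C / (1 - rate x t) + (1 - x)⁻¹ * M, fun T => ?_⟩
  have hgeom := expectedSum_play_mul_pow_le (playLaw ε) p o hC0 (rate_pos x t).le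
    (rate_lt_one hxt.ne) T
  have hinv : expectedSum (playLaw ε) p T
      (fun h => playProb (playLaw ε) h o * invBernstein x t (pulls h o) (successes h o))
        ≤ (1 - x)⁻¹ * M := by
    calc _ ≤ ∑ j ∈ Finset.range T, (trial (p o))^[j] (invBernstein x t) 0 0 :=
          expectedSum_play_le_sum_trial (playLaw ε) p o (invBernstein_nonneg hx0.le hx1.le t) T
      _ ≤ ∑ j ∈ Finset.range T, (1 - x)⁻¹ * (((j : ℝ) + 1) * ρ ^ j) :=
          Finset.sum_le_sum fun j _ =>
            iterate_trial_invBernstein_le (p o).2.1 (p o).2.2 hx0 hx1 hρ0 hratio j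
      _ ≤ (1 - x)⁻¹ * M := by
          rw [← Finset.mul_sum]
          exact mul_le_mul_of_nonneg_left (hM T) (inv_nonneg.2 (sub_pos.2 hx1).le)
  refine le_trans (expectedSum_mono (playLaw ε) p T fun h =>
    mul_le_mul_of_nonneg_left (hC h o) (playProb_nonneg _ _ _)) ?_
  simp only [mul_add]
  exact (map_add (expectedSum (playLaw ε) p T) _ _).trans_le (add_le_add hgeom hinv)

end Underestimation

/-! ### Domination of the posterior of a well-explored arm -/

section Domination

variable {j k k' l n : ℕ} {x y z ρ : ℝ}

lemma pow_mul_one_sub_pow_le (hy0 : 0 < y) (hyx : y ≤ x) (hx : x < 1)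
    (hkl : (k : ℝ) * (1 - y) ≤ l * y) :
    x ^ k * (1 - x) ^ l ≤ y ^ k * (1 - y) ^ l := by
  have hy1 : 0 < 1 - y := by linarith
  have : 0 < 1 - x := by linarith
  have hx0 : 0 < x := by linarith
  have hpow : ∀ {r : ℝ}, 0 ≤ r → ∀ i : ℕ, r ^ i ≤ Real.exp (i * (r - 1)) := fun {r} hr i => by
    rw [Real.exp_nat_mul]
    exact pow_le_pow_left₀ hr (by linarith [Real.add_one_le_exp (r - 1)]) i
  have hexponent : (k : ℝ) * (x / y - 1) + l * ((1 - x) / (1 - y) - 1)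
      = (x - y) * (k * (1 - y) - l * y) / (y * (1 - y)) := by
    field_simp
    ring
  have hratio : (x / y) ^ k * ((1 - x) / (1 - y)) ^ l ≤ 1 := by
    refine (mul_le_mul (hpow (by positivity) k) (hpow (by positivity) l) (by positivity)
      (Real.exp_pos _).le).trans ?_
    rw [← Real.exp_add, Real.exp_le_one_iff, hexponent]
    exact div_nonpos_of_nonpos_of_nonneg
      (mul_nonpos_of_nonneg_of_nonpos (by linarith) (by linarith)) (by positivity)
  rwa [div_pow, div_pow, div_mul_div_comm, div_le_one (by positivity)] at hratio

lemma pow_le_eval_bernsteinPolynomial (hk : k ≤ n) (hy0 : 0 ≤ y) (hyx : y ≤ x) (hx : x ≤ 1) :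
    y ^ n * (1 - x) ^ n ≤ (bernsteinPolynomial ℝ n k).eval x := by
  have hx0 := hy0.trans hyx
  have hx1 := sub_nonneg.2 hx
  calc y ^ n * (1 - x) ^ n ≤ x ^ k * (1 - x) ^ (n - k) :=
        mul_le_mul ((pow_le_pow_left₀ hy0 hyx n).trans (pow_le_pow_of_le_one hx0 hx hk))
          (pow_le_pow_of_le_one hx1 (by linarith) (n.sub_le k)) (by positivity) (by positivity)
    _ ≤ n.choose k * (x ^ k * (1 - x) ^ (n - k)) :=
        le_mul_of_one_le_left (by positivity) (by exact_mod_cast Nat.choose_pos hk)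
    _ = (bernsteinPolynomial ℝ n k).eval x := by rw [eval_bernsteinPolynomial, mul_assoc]

lemma eval_bernsteinPolynomial_le_rate_pow (hz : 0 ≤ z) (hzy : z < y) (hyx : y ≤ x) (hx : x < 1)
    (hkz : (k : ℝ) ≤ z * j) (hn : (n : ℝ) * y ≤ j * (y - z)) :
    (bernsteinPolynomial ℝ j k).eval x ≤ rate y z ^ j * ((1 - y) ^ n)⁻¹ * (1 - x) ^ n := by
  have hy0 : 0 < y := hz.trans_lt hzy
  have hy1 : 0 < 1 - y := by linarith
  have hx1 : 0 < 1 - x := by linarith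
  have hkn : k + n ≤ j := by
    have : ((k : ℝ) + n) * y ≤ j * y := by nlinarith [Nat.cast_nonneg (α := ℝ) k]
    exact_mod_cast le_of_mul_le_mul_right this hy0
  obtain ⟨l, rfl⟩ : ∃ l, j = k + (l + n) := ⟨j - k - n, by omega⟩
  have hmode : x ^ k * (1 - x) ^ l ≤ y ^ k * (1 - y) ^ l :=
    pow_mul_one_sub_pow_le hy0 hyx hx (by push_cast at hkz hn; nlinarith)
  have hrate : (bernsteinPolynomial ℝ (k + (l + n)) k).eval y ≤ rate y z ^ (k + (l + n)) :=
    (eval_bernsteinPolynomial_le_binCDF _ le_rfl hy0.le (by linarith)).trans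
      (binCDF_le_rate_pow hz hzy.le (by linarith) hkz)
  rw [eval_bernsteinPolynomial, Nat.add_sub_cancel_left] at hrate ⊢
  calc ((k + (l + n)).choose k : ℝ) * x ^ k * (1 - x) ^ (l + n)
      = (k + (l + n)).choose k * (x ^ k * (1 - x) ^ l) * (1 - x) ^ n := by
        rw [pow_add]
        ring
    _ ≤ (k + (l + n)).choose k * (y ^ k * (1 - y) ^ l) * (1 - x) ^ n := by gcongr
    _ = (k + (l + n)).choose k * y ^ k * (1 - y) ^ (l + n) * ((1 - y) ^ n)⁻¹ * (1 - x) ^ n := by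
        rw [pow_add]
        field_simp
    _ ≤ rate y z ^ (k + (l + n)) * ((1 - y) ^ n)⁻¹ * (1 - x) ^ n := by gcongr

lemma betaDensity_le (hk' : k' ≤ n) (hz : 0 ≤ z) (hzy : z < y) (hyx : y ≤ x) (hx : x < 1)
    (hkz : (k : ℝ) ≤ z * j) (hn : (n : ℝ) * y ≤ j * (y - z)) :
    (j + 1) * (bernsteinPolynomial ℝ j k).eval x
      ≤ (j + 1) * rate y z ^ j * ((y * (1 - y)) ^ n)⁻¹
        * ((n + 1) * (bernsteinPolynomial ℝ n k').eval x) := by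
  have hy0 : 0 < y := hz.trans_lt hzy
  have hy1 : 0 < 1 - y := by linarith
  have := rate_pos y z
  have hlower : y ^ n * (1 - x) ^ n ≤ (n + 1) * (bernsteinPolynomial ℝ n k').eval x :=
    (pow_le_eval_bernsteinPolynomial hk' hy0.le hyx hx.le).trans (le_mul_of_one_le_left
      (eval_bernsteinPolynomial_nonneg n k' (hy0.le.trans hyx) hx.le)
      (le_add_of_nonneg_left n.cast_nonneg))
  calc (j + 1) * (bernsteinPolynomial ℝ j k).eval x
      ≤ (j + 1) * (rate y z ^ j * ((1 - y) ^ n)⁻¹ * (1 - x) ^ n) :=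
        mul_le_mul_of_nonneg_left (eval_bernsteinPolynomial_le_rate_pow hz hzy hyx hx hkz hn)
          (by positivity)
    _ = (j + 1) * rate y z ^ j * ((y * (1 - y)) ^ n)⁻¹ * (y ^ n * (1 - x) ^ n) := by
        rw [mul_pow]
        field_simp
    _ ≤ _ := by gcongr

lemma betaMeasure_inter_Ioi_le (hk : k ≤ j) (hk' : k' ≤ n) (hy0 : 0 ≤ y) {r : ℝ≥0}
    (hle : ∀ x ∈ Set.Ioo y 1, (j + 1) * (bernsteinPolynomial ℝ j k).eval x
      ≤ r * ((n + 1) * (bernsteinPolynomial ℝ n k').eval x))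
    {s : Set ℝ} (hs : MeasurableSet s) :
    betaMeasure ((k : ℝ) + 1) ((j : ℝ) + 2 - (k + 1)) (s ∩ Set.Ioi y)
      ≤ r * betaMeasure ((k' : ℝ) + 1) ((n : ℝ) + 2 - (k' + 1)) (s ∩ Set.Ioi y) := by
  have hmeas : Measurable (betaPDF ((k' : ℝ) + 1) ((n : ℝ) + 2 - (k' + 1))) :=
    (measurable_betaPDFReal _ _).ennreal_ofReal
  rw [betaMeasure_inter_Ioi hs, betaMeasure_inter_Ioi hs, ← lintegral_const_mul _ hmeas]
  refine setLIntegral_mono' (hs.inter measurableSet_Ioo) fun x ⟨_, hyx, hx1⟩ => ?_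
  have hx0 := hy0.trans_lt hyx
  rw [betaPDF_natCast hk hx0 hx1, betaPDF_natCast hk' hx0 hx1, ← ENNReal.ofReal_coe_nnreal,
    ← ENNReal.ofReal_mul r.coe_nonneg]
  exact ENNReal.ofReal_le_ofReal (hle x ⟨hyx, hx1⟩)

lemma exists_mul_pow_le_half_pow {D : ℝ} (hρ0 : 0 < ρ) (hρ1 : ρ < 1) (hD : 0 < D) :
    ∃ (κ : ℕ) (M : ℝ≥0), ∀ j n : ℕ, κ * n ≤ j →
      (j + 1) * ρ ^ j * (D ^ n)⁻¹ ≤ M * (1 / 2) ^ n := by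
  set σ := √ρ
  have hσ0 : 0 < σ := Real.sqrt_pos.2 hρ0
  have hσ1 : σ < 1 := (Real.sqrt_lt' one_pos).2 (by simpa using hρ1)
  obtain ⟨M, hM⟩ := exists_sum_mul_geometric_le hσ0.le hσ1
  obtain ⟨κ, hκ⟩ := exists_pow_lt_of_lt_one (show 0 < D / 2 by positivity) hσ1
  refine ⟨κ, ⟨M, by simpa using hM 0⟩, fun j n hj => ?_⟩
  have hterm : (j + 1) * σ ^ j ≤ M :=
    (Finset.single_le_sum (f := fun j : ℕ => ((j : ℝ) + 1) * σ ^ j) (fun i _ => by positivity)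
      (Finset.self_mem_range_succ j)).trans (hM (j + 1))
  have hpow : σ ^ j ≤ (D / 2) ^ n := by
    refine (pow_le_pow_of_le_one hσ0.le hσ1.le hj).trans ?_
    rw [pow_mul]
    exact pow_le_pow_left₀ (by positivity) hκ.le n
  calc (j + 1) * ρ ^ j * (D ^ n)⁻¹ = (j + 1) * σ ^ j * (σ ^ j * (D ^ n)⁻¹) := by
        rw [← Real.mul_self_sqrt hρ0.le, mul_pow]
        ring
    _ ≤ M * ((D / 2) ^ n * (D ^ n)⁻¹) :=
        mul_le_mul hterm (by gcongr) (by positivity) (by simpa using hM 0)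
    _ = M * (1 / 2) ^ n := by
        rw [div_pow, div_pow, one_pow]
        field_simp

variable {ε : ℝ}

lemma klReal_div_pos (hz : 0 < z) (hzy : z < y) (hy : y < 1 - ε) :
    0 < klReal (z / (1 - ε)) (y / (1 - ε)) := by
  have hr : 0 < 1 - ε := by linarith
  have hzy' : z / (1 - ε) < y / (1 - ε) := div_lt_div_of_pos_right hzy hr
  have hy' : y / (1 - ε) < 1 := (div_lt_one hr).2 hy
  exact klReal_pos (div_pos hz hr).le (hzy'.trans hy').le (div_pos (hz.trans hzy) hr) hy' hzy'.ne

lemma exists_half_le_posterior_real_Iic (hε : ε < 1) (hz : 0 < z) (hzy : z < y) (hy : y < 1 - ε) :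
    ∃ κ : ℕ, ∀ {K : ℕ} (h : History K) (a : Fin K), (successes h a : ℝ) ≤ z * pulls h a →
      κ ≤ pulls h a → 1 / 2 ≤ (posterior ε h a).real (Set.Iic y) := by
  have hkl := klReal_div_pos hz hzy hy
  obtain ⟨κ, hκ⟩ := exists_nat_ge (1 / klReal (z / (1 - ε)) (y / (1 - ε)))
  refine ⟨κ, fun h a hs hpulls => ?_⟩
  have hone : 1 ≤ pulls h a * klReal (z / (1 - ε)) (y / (1 - ε)) :=
    (div_le_iff₀ hkl).1 (hκ.trans (Nat.cast_le.2 hpulls))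
  have htail : (posterior ε h a).real (Set.Ioi y) ≤ 1 / 2 :=
    calc (posterior ε h a).real (Set.Ioi y)
        ≤ Real.exp (-(pulls h a * klReal (z / (1 - ε)) (y / (1 - ε)))) :=
          posterior_real_Ioi_le_exp hε hz hzy hy hs
      _ ≤ Real.exp (-1) := Real.exp_le_exp.2 (neg_le_neg hone)
      _ ≤ 1 / 2 := by
          rw [Real.exp_neg, ← one_div]
          exact one_div_le_one_div_of_le two_pos (by linarith [Real.add_one_le_exp 1])
  rw [← Set.compl_Ioi, probReal_compl_eq_one_sub measurableSet_Ioi]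
  linarith

lemma exists_posterior_inter_Ioi_le (hε : ε < 1) (hz : 0 < z) (hzy : z < y) (hy : y < 1 - ε) :
    ∃ (κ : ℕ) (M : ℝ≥0), ∀ {K : ℕ} (h : History K) (a o : Fin K),
      (successes h a : ℝ) ≤ z * pulls h a → empMean h o ≤ 1 - ε →
      κ * pulls h o ≤ pulls h a → ∀ s, MeasurableSet s →
        posterior ε h a (s ∩ Set.Ioi y)
          ≤ (M * (1 / 2) ^ pulls h o : ℝ≥0) * posterior ε h o (s ∩ Set.Ioi y) := by
  have hr : 0 < 1 - ε := by linarith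
  set z' := z / (1 - ε)
  set y' := y / (1 - ε)
  have hz' : 0 < z' := div_pos hz hr
  have hzy' : z' < y' := div_lt_div_of_pos_right hzy hr
  have hy' : y' < 1 := (div_lt_one hr).2 hy
  obtain ⟨κ₁, M, hM⟩ := exists_mul_pow_le_half_pow (rate_pos y' z') (rate_lt_one hzy'.ne')
    (mul_pos (hz'.trans hzy') (sub_pos.2 hy'))
  obtain ⟨κ₂, hκ₂⟩ := exists_nat_ge (y' / (y' - z'))
  rw [div_le_iff₀ (sub_pos.2 hzy')] at hκ₂
  refine ⟨max κ₁ κ₂, M, fun h a o hs ho hpulls s hmeas => ?_⟩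
  have ha : empMean h a ≤ 1 - ε := (empMean_le_of_successes_le hz.le hs).trans (by linarith)
  have hκ₁n : κ₁ * pulls h o ≤ pulls h a :=
    (Nat.mul_le_mul_right _ (le_max_left _ _)).trans hpulls
  have hκ₂n : (κ₂ : ℝ) * pulls h o ≤ pulls h a := by
    exact_mod_cast (Nat.mul_le_mul_right _ (le_max_right _ _)).trans hpulls
  rw [posterior_inter_Ioi hε ha y hmeas, posterior_inter_Ioi hε ho y hmeas]
  refine betaMeasure_inter_Ioi_le (scaledSuccesses_le_pulls ha) (scaledSuccesses_le_pulls ho)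
    (hz'.trans hzy').le (fun x ⟨hyx, hx1⟩ => ?_) (measurable_const_mul _ hmeas)
  have hn : pulls h o * y' ≤ pulls h a * (y' - z') := by
    calc pulls h o * y' ≤ pulls h o * (κ₂ * (y' - z')) := by gcongr
      _ = κ₂ * pulls h o * (y' - z') := by ring
      _ ≤ pulls h a * (y' - z') := mul_le_mul_of_nonneg_right hκ₂n (sub_pos.2 hzy').le
  refine (betaDensity_le (scaledSuccesses_le_pulls ho) hz'.le hzy' hyx.le hx1
    (scaledSuccesses_le_of_successes_le hε hs) hn).trans (mul_le_mul_of_nonneg_right ?_ ?_)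
  · push_cast
    exact hM _ _ hκ₁n
  · exact mul_nonneg (by positivity)
      (eval_bernsteinPolynomial_nonneg _ _ ((hz'.trans hzy').trans hyx).le hx1.le)

end Domination

/-! ### Plays of the bad arms -/

section Plays

variable {K : ℕ} (π : History K → PMF (Fin K)) (p : Fin K → unitInterval)

/-- The expected number of rounds among the first `T` in which arm `a` is played and the history
before the round lies in `E`, for the policy `π` and Bernoulli arms with means `p`. -/
def expectedPlays (a : Fin K) (E : Set (History K)) (T : ℕ) : ℝ :=
  expectedSum π p T (fun h => playProb π h a * E.indicator 1 h)

lemma expectedPlays_union_le (a : Fin K) (E F : Set (History K)) (T : ℕ) :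
    expectedPlays π p a (E ∪ F) T ≤ expectedPlays π p a E T + expectedPlays π p a F T := by
  classical
  rw [expectedPlays, expectedPlays, expectedPlays, ← map_add]
  refine expectedSum_mono π p T fun h => ?_
  rw [Pi.add_apply, ← mul_add]
  refine mul_le_mul_of_nonneg_left ?_ (playProb_nonneg π h a)
  by_cases hE : h ∈ E <;> by_cases hF : h ∈ F <;> simp [hE, hF]

lemma expectedSum_play_le_add (a : Fin K) (E : Set (History K)) {φ : History K → ℝ} (hφ : 0 ≤ φ)
    (hE : ∀ h ∉ E, playProb π h a ≤ φ h) (T : ℕ) :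
    expectedSum π p T (fun h => playProb π h a)
      ≤ expectedPlays π p a E T + expectedSum π p T φ := by
  rw [expectedPlays, ← map_add]
  refine expectedSum_mono π p T fun h => ?_
  by_cases hh : h ∈ E
  · simpa [hh] using hφ h
  · simpa [hh] using hE h hh

lemma exists_expectedPlays_overestimated_le (a : Fin K) {z : ℝ} (hz : p a < z) (hz1 : z ≤ 1) :
    ∃ M, ∀ T, expectedPlays π p a {h | z * pulls h a < successes h a} T ≤ M := by
  refine ⟨_, fun T => expectedSum_play_le_of_trial_le_mul π p a (w := tilt (p a) z)
    (rate_lt_one hz.ne) (fun n s => (tilt_pos _ _ _ _).le)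
    (trial_tilt_le (p a).2.1 (p a).2.2 ((p a).2.1.trans hz.le) hz1) (fun h => ?_) T⟩
  exact Set.indicator_apply_le' (fun hs => one_le_tilt_of_ge hz.le (le_of_lt hs))
    fun _ => (tilt_pos _ _ _ _).le

lemma exists_le_pow {r : ℝ} (hr0 : 0 < r) (hr1 : r < 1) (κ : ℕ) :
    ∃ q, 0 < q ∧ q < 1 ∧ r ≤ q ^ κ := by
  have hq0 : 0 < r ^ ((κ + 1 : ℕ) : ℝ)⁻¹ := Real.rpow_pos_of_pos hr0 _
  have hq1 : r ^ ((κ + 1 : ℕ) : ℝ)⁻¹ < 1 := Real.rpow_lt_one hr0.le hr1 (by positivity)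
  refine ⟨_, hq0, hq1, ?_⟩
  calc r = (r ^ ((κ + 1 : ℕ) : ℝ)⁻¹) ^ (κ + 1) :=
        (Real.rpow_inv_natCast_pow hr0.le κ.succ_ne_zero).symm
    _ ≤ _ := pow_le_pow_of_le_one hq0.le hq1.le κ.le_succ

variable {a o : Fin K}

lemma expectedPlays_pulls_lt_le (hao : a ≠ o) {L : ℝ} (hL : 0 ≤ L) (T : ℕ) :
    expectedPlays π p a {h | pulls h a < L} T ≤ L + 1 := by
  simpa [expectedPlays] using expectedSum_play_le_of_pulls_lt π p hao (u := fun _ _ => 1) hL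
    (fun _ _ => zero_le_one) (fun n s => le_of_eq (by rw [trial]; ring))
    (c := Set.indicator {h | (pulls h a : ℝ) < L} 1)
    (fun h _ => Set.indicator_le_self' (fun _ _ => zero_le_one) h)
    (fun h hh => (Set.indicator_of_notMem (not_lt.2 hh) 1).le) T

lemma expectedPlays_underestimated_le (hao : a ≠ o) {t L : ℝ} (ht0 : 0 ≤ t) (ht : t < p o)
    (hL : 0 ≤ L) (m T : ℕ) :
    expectedPlays π p a
        {h | pulls h a < L ∧ m ≤ pulls h o ∧ (successes h o : ℝ) ≤ t * pulls h o} T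
      ≤ (L + 1) * rate (p o) t ^ m := by
  have hρ0 := rate_pos (p o) t
  have hρ1 := rate_le_one (p o) t
  let u : ℕ → ℕ → ℝ := fun n s => rate (p o) t ^ (m - n) * tilt (p o) t n s
  have hu0 : ∀ n s, 0 ≤ u n s := fun n s => mul_nonneg (by positivity) (tilt_pos _ _ _ _).le
  have hu : ∀ n s, trial (p o) u n s ≤ u n s := fun n s => by
    calc trial (p o) u n s
        = rate (p o) t ^ (m - (n + 1)) * trial (p o) (tilt (p o) t) n s := by
          simp only [trial, u]
          ring
      _ ≤ rate (p o) t ^ (m - (n + 1)) * (rate (p o) t * tilt (p o) t n s) :=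
          mul_le_mul_of_nonneg_left
            (trial_tilt_le (p o).2.1 (p o).2.2 ht0 (ht.le.trans (p o).2.2) n s) (by positivity)
      _ = rate (p o) t ^ (m - (n + 1) + 1) * tilt (p o) t n s := by ring
      _ ≤ u n s := mul_le_mul_of_nonneg_right
          (pow_le_pow_of_le_one hρ0.le hρ1 (by omega)) (tilt_pos _ _ _ _).le
  refine (expectedSum_play_le_of_pulls_lt π p hao hL hu0 hu (fun h _ => ?_) (fun h hh => ?_)
    T).trans_eq (by simp [u, tilt_zero])
  · refine Set.indicator_apply_le' (fun ⟨_, hm, hs⟩ => ?_) fun _ => hu0 _ _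
    simpa [u, Nat.sub_eq_zero_of_le hm] using one_le_tilt_of_le ht.le hs
  · exact (Set.indicator_of_notMem (fun hmem => hh.not_gt hmem.1) 1).le

lemma exists_expectedPlays_underestimated_le (hao : a ≠ o) {t : ℝ} (ht0 : 0 ≤ t)
    (ht : t < p o) (κ : ℕ) :
    ∃ M, ∀ T, expectedPlays π p a
      {h | (successes h o : ℝ) ≤ t * pulls h o ∧ pulls h a < κ * (pulls h o + 1)} T ≤ M := by
  obtain ⟨q, hq0, hq1, hq⟩ := exists_le_pow (rate_pos (p o) t) (rate_lt_one ht.ne') κ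
  let u : ℕ → ℕ → ℝ := fun n s => (q ^ (κ * (n + 1)))⁻¹ * tilt (p o) t n s
  have hu0 : ∀ n s, 0 ≤ u n s := fun n s => mul_nonneg (by positivity) (tilt_pos _ _ _ _).le
  have hu : ∀ n s, trial (p o) u n s ≤ u n s := fun n s => by
    calc trial (p o) u n s
        = (q ^ (κ * (n + 1)))⁻¹ * ((q ^ κ)⁻¹ * trial (p o) (tilt (p o) t) n s) := by
          simp only [trial, u, Nat.mul_succ κ (n + 1), pow_add _ (κ * (n + 1)), mul_inv]
          ring
      _ ≤ u n s := by
          refine mul_le_mul_of_nonneg_left ((inv_mul_le_iff₀ (by positivity)).2 ?_) (by positivity)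
          exact (trial_tilt_le (p o).2.1 (p o).2.2 ht0 (ht.le.trans (p o).2.2) n s).trans
            (mul_le_mul_of_nonneg_right hq (tilt_pos _ _ _ _).le)
  refine ⟨_, fun T => expectedSum_play_le_of_pow_pulls π p hao hq0.le hq1 hu0 hu (fun h => ?_) T⟩
  refine Set.indicator_apply_le' (fun ⟨hs, hpulls⟩ => ?_)
    fun _ => mul_nonneg (by positivity) (hu0 _ _)
  have hpow : 1 ≤ q ^ pulls h a * (q ^ (κ * (pulls h o + 1)))⁻¹ := by
    rw [← div_eq_mul_inv, one_le_div (by positivity)]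
    exact pow_le_pow_of_le_one hq0.le hq1.le hpulls.le
  calc (1 : ℝ) ≤ q ^ pulls h a * (q ^ (κ * (pulls h o + 1)))⁻¹
          * tilt (p o) t (pulls h o) (successes h o) :=
        one_le_mul_of_one_le_of_one_le hpow (one_le_tilt_of_le ht.le hs)
    _ = q ^ pulls h a * u (pulls h o) (successes h o) := mul_assoc _ _ _

end Plays

section BadArms

variable {K : ℕ} [NeZero K] {ε z y : ℝ} {h : History K} {a o : Fin K}

lemma playProb_playLaw_eq_zero (hε : ε < 1) (ha : empMean h a ≤ 1 - ε) (ho : 1 - ε < empMean h o) :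
    playProb (playLaw ε) h a = 0 := by
  have htail_o : (posterior ε h o).real (Set.Ioi (1 - ε)) = 1 := posterior_real_Ioi_of_lt ho le_rfl
  have htail_a : (posterior ε h a).real (Set.Ioi (1 - ε)) = 0 := by
    rw [posterior_real_Ioi hε ha (by linarith) le_rfl, div_self (by linarith),
      binCDF_one (Nat.lt_succ_of_le (scaledSuccesses_le_pulls ha))]
  have hle := toReal_winProb_le_add_tail (posterior ε h) (a := a) (1 - ε) (htail_o ▸ one_pos)
  rw [lowOdds_posterior_of_lt ho le_rfl, htail_a, zero_mul, zero_add] at hle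
  exact hle.antisymm (playProb_nonneg (playLaw ε) h a)

lemma exists_playProb_playLaw_le (K : ℕ) [NeZero K] (hε : ε < 1) (hz : 0 < z) (hzy : z < y)
    (hy : y < 1 - ε) :
    ∃ (κ : ℕ) (M : ℝ), 0 ≤ M ∧ ∀ (h : History K) (a o : Fin K), a ≠ o →
      (successes h a : ℝ) ≤ z * pulls h a →
      (empMean h o ≤ 1 - ε → κ * (pulls h o + 1) ≤ pulls h a) →
        playProb (playLaw ε) h a ≤ playProb (playLaw ε) h o
          * (lowOdds (posterior ε h o) y + M * (1 / 2) ^ pulls h o) := by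
  obtain ⟨κ₁, hκ₁⟩ := exists_half_le_posterior_real_Iic hε hz hzy hy
  obtain ⟨κ₂, M, hM⟩ := exists_posterior_inter_Ioi_le hε hz hzy hy
  refine ⟨κ₁ + κ₂, 2 * M * K, by positivity, fun h a o hao hs hpulls => ?_⟩
  have hπo := playProb_nonneg (playLaw ε) h o
  rcases le_or_gt (empMean h o) (1 - ε) with ho | ho
  · have hκ : κ₁ + κ₂ * pulls h o ≤ pulls h a := by nlinarith [hpulls ho]
    refine (toReal_winProb_le_of_dominated (posterior ε h) y hao
      (posterior_real_Ioi_pos hε h o (hz.trans hzy).le hy) (hκ₁ h a hs (by omega))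
      (hM h a o hs ho (by omega))).trans_eq ?_
    change _ * playProb (playLaw ε) h o = _
    push_cast
    ring
  · have ha : empMean h a ≤ 1 - ε := (empMean_le_of_successes_le hz.le hs).trans (by linarith)
    rw [playProb_playLaw_eq_zero hε ha ho]
    have := lowOdds_nonneg (posterior ε h o) y
    positivity

lemma exists_expectedSum_play_mul_lowOdds_add_pow_le (p : Fin K → unitInterval) (hε0 : 0 ≤ ε)
    (hε1 : ε < 1) (o : Fin K) (hy0 : 0 < y) (hy : y < p o * (1 - ε)) {C ρ : ℝ} (hC : 0 ≤ C)
    (hρ0 : 0 ≤ ρ) (hρ1 : ρ < 1) :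
    ∃ M : ℝ, ∀ T, expectedSum (playLaw ε) p T (fun h => playProb (playLaw ε) h o
      * (lowOdds (posterior ε h o) y + C * ρ ^ pulls h o)) ≤ M := by
  obtain ⟨M, hM⟩ := exists_expectedSum_play_mul_lowOdds_le p hε0 hε1 o hy0
    ((div_lt_iff₀ (by linarith)).2 hy)
  refine ⟨M + C / (1 - ρ), fun T => ?_⟩
  simp only [mul_add]
  exact (map_add (expectedSum (playLaw ε) p T) _ _).trans_le
    (add_le_add (hM T) (expectedSum_play_mul_pow_le (playLaw ε) p o hC hρ0 hρ1 T))

lemma exists_expectedSum_play_le (p : Fin K → unitInterval) (hε0 : 0 ≤ ε) (hε1 : ε < 1)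
    (ho : 1 - ε < p o) (ha : p a < p o * (1 - ε)) :
    ∃ M, ∀ T, expectedSum (playLaw ε) p T (fun h => playProb (playLaw ε) h a) ≤ M := by
  have hr : 0 < 1 - ε := by linarith
  have hao : a ≠ o := by
    rintro rfl
    exact ha.not_ge (mul_le_of_le_one_right (p a).2.1 (by linarith))
  obtain ⟨y, hay, hyo⟩ := exists_between ha
  obtain ⟨z, haz, hzy⟩ := exists_between hay
  have hz0 : 0 < z := (p a).2.1.trans_lt haz
  have hyε : y < 1 - ε := hyo.trans_le (mul_le_of_le_one_left hr.le (p o).2.2)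
  obtain ⟨κ, C, hC0, hC⟩ := exists_playProb_playLaw_le K hε1 hz0 hzy hyε
  obtain ⟨M₁, hM₁⟩ := exists_expectedPlays_overestimated_le (playLaw ε) p a haz (by linarith)
  obtain ⟨M₂, hM₂⟩ := exists_expectedPlays_underestimated_le (playLaw ε) p hao hr.le ho κ
  obtain ⟨M₃, hM₃⟩ := exists_expectedSum_play_mul_lowOdds_add_pow_le p hε0 hε1 o (hz0.trans hzy)
    hyo hC0 one_half_pos.le one_half_lt_one
  refine ⟨M₁ + M₂ + M₃, fun T => ?_⟩
  refine (expectedSum_play_le_add (playLaw ε) p a _ (fun h => ?_) (fun h hE => ?_) T).trans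
    (add_le_add ((expectedPlays_union_le _ _ _ _ _ _).trans (add_le_add (hM₁ T) (hM₂ T))) (hM₃ T))
  · have := lowOdds_nonneg (posterior ε h o) y
    exact mul_nonneg (playProb_nonneg _ _ _) (by positivity)
  · simp only [Set.mem_union, Set.mem_ofPred_eq, not_or, not_and, not_lt] at hE
    exact hC h a o hao hE.1 fun hmean => hE.2 (successes_le_of_empMean_le hmean)

lemma playProb_playLaw_le_add_inv (hε : ε < 1) (hz : 0 < z) (hzy : z < y) (hy : y < 1 - ε) {T : ℝ}
    (hT : 0 < T) (hs : (successes h a : ℝ) ≤ z * pulls h a)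
    (hpulls : Real.log T / klReal (z / (1 - ε)) (y / (1 - ε)) ≤ pulls h a) :
    playProb (playLaw ε) h a
      ≤ playProb (playLaw ε) h o * lowOdds (posterior ε h o) y + T⁻¹ := by
  have htail : (posterior ε h a).real (Set.Ioi y) ≤ T⁻¹ :=
    calc (posterior ε h a).real (Set.Ioi y)
        ≤ Real.exp (-(pulls h a * klReal (z / (1 - ε)) (y / (1 - ε)))) :=
          posterior_real_Ioi_le_exp hε hz hzy hy hs
      _ ≤ Real.exp (-Real.log T) :=
          Real.exp_le_exp.2 (neg_le_neg ((div_le_iff₀ (klReal_div_pos hz hzy hy)).1 hpulls))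
      _ = T⁻¹ := by rw [Real.exp_neg, Real.exp_log hT]
  rw [mul_comm]
  exact (toReal_winProb_le_add_tail (posterior ε h) y
    (posterior_real_Ioi_pos hε h o (hz.trans hzy).le hy)).trans (add_le_add_right htail _)

lemma playProb_playLaw_le_mul_add_inv (hε : ε < 1) (hz : 0 < z) {x : ℝ} (hzx : z < x)
    (hx : x < 1 - ε) (hzy : z < y) (hy : y < 1 - ε) {T c : ℝ} (hT : 0 < T) (hc : 0 ≤ c)
    (hs : (successes h a : ℝ) ≤ z * pulls h a)
    (hpulls : Real.log T / klReal (z / (1 - ε)) (y / (1 - ε)) ≤ pulls h a)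
    (hlow : pulls h a < Real.log T / klReal (z / (1 - ε)) (x / (1 - ε)) →
      lowOdds (posterior ε h o) y ≤ c) :
    playProb (playLaw ε) h a
      ≤ playProb (playLaw ε) h o * (lowOdds (posterior ε h o) x + c) + T⁻¹ := by
  have hmono : ∀ {d}, d ≤ lowOdds (posterior ε h o) x + c → playProb (playLaw ε) h o * d + T⁻¹
      ≤ playProb (playLaw ε) h o * (lowOdds (posterior ε h o) x + c) + T⁻¹ := fun hd =>
    add_le_add_left (mul_le_mul_of_nonneg_left hd (playProb_nonneg _ _ _)) _
  rcases lt_or_ge (pulls h a : ℝ) (Real.log T / klReal (z / (1 - ε)) (x / (1 - ε))) with hlt | hge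
  · exact (playProb_playLaw_le_add_inv hε hz hzy hy hT hs hpulls).trans
      (hmono (le_add_of_nonneg_of_le (lowOdds_nonneg _ _) (hlow hlt)))
  · exact (playProb_playLaw_le_add_inv hε hz hzx hx hT hs hge).trans
      (hmono (le_add_of_nonneg_right hc))

lemma exists_expectedSum_play_le_log (p : Fin K → unitInterval) (hε0 : 0 ≤ ε) (hε1 : ε < 1)
    (ho : p o ≤ 1 - ε) {x w : ℝ} (haz : p a < z) (hzx : z < x) (hxo : x < p o * (1 - ε))
    (hzy : z < y) (hyw : y < w) (hwo : w < p o) (m : ℕ) :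
    ∃ M, ∀ T : ℕ, 1 ≤ T → expectedSum (playLaw ε) p T (fun h => playProb (playLaw ε) h a)
      ≤ Real.log T / klReal (z / (1 - ε)) (y / (1 - ε))
        + Real.log T / klReal (z / (1 - ε)) (x / (1 - ε)) * rate (p o) w ^ m + M := by
  have hr : 0 < 1 - ε := by linarith
  have hao : a ≠ o := by
    rintro rfl
    linarith
  have hz0 : 0 < z := (p a).2.1.trans_lt haz
  have hxε : x < 1 - ε := hxo.trans_le (mul_le_of_le_one_left hr.le (p o).2.2)
  have hyε : y < 1 - ε := by linarith
  have hDy := klReal_div_pos hz0 hzy hyε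
  have hDx := klReal_div_pos hz0 hzx hxε
  obtain ⟨M₁, hM₁⟩ := exists_expectedPlays_overestimated_le (playLaw ε) p a haz (by linarith)
  obtain ⟨C, ρ, hC0, hρ0, hρ1, hC⟩ := exists_lowOdds_posterior_le_of_not_underestimated hε1
    (hz0.trans hzy).le hyw (hwo.le.trans ho) m
  obtain ⟨M₂, hM₂⟩ := exists_expectedSum_play_mul_lowOdds_add_pow_le p hε0 hε1 o (hz0.trans hzx)
    hxo hC0 hρ0 hρ1
  refine ⟨M₁ + 1 + rate (p o) w ^ m + (M₂ + 1), fun T hT => ?_⟩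
  have hT0 : (0 : ℝ) < T := by exact_mod_cast hT
  have hlog : 0 ≤ Real.log T := Real.log_natCast_nonneg T
  have hE := (expectedPlays_union_le (playLaw ε) p a _ _ T).trans (add_le_add
    ((expectedPlays_union_le (playLaw ε) p a _ _ T).trans (add_le_add (hM₁ T)
      (expectedPlays_pulls_lt_le (playLaw ε) p hao (div_nonneg hlog hDy.le) T)))
    (expectedPlays_underestimated_le (playLaw ε) p hao (hz0.trans (hzy.trans hyw)).le hwo
      (div_nonneg hlog hDx.le) m T))
  refine (expectedSum_play_le_add (playLaw ε) p a _ (φ := (fun h => playProb (playLaw ε) h o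
    * (lowOdds (posterior ε h o) x + C * ρ ^ pulls h o)) + fun _ => (T : ℝ)⁻¹)
    (fun h => ?_) (fun h hh => ?_) T).trans ((add_le_add_left hE _).trans ?_)
  · have := lowOdds_nonneg (posterior ε h o) x
    exact add_nonneg (mul_nonneg (playProb_nonneg _ _ _) (by positivity)) (by positivity)
  · simp only [Set.mem_union, Set.mem_ofPred_eq, not_or, not_lt] at hh
    obtain ⟨⟨hs, hfew⟩, hunder⟩ := hh
    exact playProb_playLaw_le_mul_add_inv hε1 hz0 hzx hxε hzy hyε hT0 (by positivity) hs hfew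
      fun hlt => hC h o fun hm => hunder ⟨hlt, hm⟩
  · rw [map_add, expectedSum_const, mul_inv_cancel₀ hT0.ne']
    linarith [hM₂ T]

lemma eventually_expectedSum_play_le (p : Fin K → unitInterval) (hε0 : 0 ≤ ε) (hε1 : ε < 1)
    (ho : p o ≤ 1 - ε) (haz : p a < z) (hzo : z < p o * (1 - ε)) (hzy : z < y) (hyo : y < p o)
    {η : ℝ} (hη : 0 < η) :
    ∀ᶠ T : ℕ in atTop, expectedSum (playLaw ε) p T (fun h => playProb (playLaw ε) h a)
      ≤ (1 / klReal (z / (1 - ε)) (y / (1 - ε)) + η) * Real.log T := by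
  obtain ⟨x, hzx, hxo⟩ := exists_between hzo
  obtain ⟨w, hyw, hwo⟩ := exists_between hyo
  set D := klReal (z / (1 - ε)) (x / (1 - ε))
  have hD : 0 < D := klReal_div_pos ((p a).2.1.trans_lt haz) hzx
    (hxo.trans_le (mul_le_of_le_one_left (by linarith) (p o).2.2))
  obtain ⟨m, hm⟩ := exists_pow_lt_of_lt_one (show 0 < η / 2 * D by positivity)
    (rate_lt_one hwo.ne')
  obtain ⟨M, hM⟩ := exists_expectedSum_play_le_log p hε0 hε1 ho haz hzx hxo hzy hyw hwo m
  have hlim : Tendsto (fun T : ℕ => Real.log (T : ℝ)) atTop atTop :=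
    Real.tendsto_log_atTop.comp tendsto_natCast_atTop_atTop
  filter_upwards [eventually_ge_atTop 1, hlim.eventually_ge_atTop (M / (η / 2))] with T hT hTM
  have hrate : Real.log T / D * rate (p o) w ^ m ≤ Real.log T * (η / 2) := by
    rw [div_mul_eq_mul_div, div_le_iff₀ hD, mul_assoc]
    exact mul_le_mul_of_nonneg_left hm.le (Real.log_natCast_nonneg T)
  have hMlog : M ≤ Real.log T * (η / 2) := (div_le_iff₀ (by positivity)).1 hTM
  refine (hM T hT).trans ?_
  linear_combination hrate + hMlog

end BadArms

/-! ### Continuity of the relative entropy -/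

section KullbackLeibler

variable {p q c : ℝ}

lemma klReal_eq_neg_binEntropy_sub (p : ℝ) (hq0 : 0 < q) (hq1 : q < 1) :
    klReal p q = -Real.binEntropy p - p * Real.log q - (1 - p) * Real.log (1 - q) := by
  have mul_log_div : ∀ x y : ℝ, y ≠ 0 →
      x * Real.log (x / y) = x * Real.log x - x * Real.log y := fun x y hy => by
    rcases eq_or_ne x 0 with rfl | hx
    · simp
    · rw [Real.log_div hx hy, mul_sub]
  rw [klReal, mul_log_div _ _ hq0.ne', mul_log_div _ _ (sub_pos.2 hq1).ne', Real.binEntropy,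
    Real.log_inv, Real.log_inv]
  ring

lemma continuous_klReal_left (hq0 : 0 < q) (hq1 : q < 1) : Continuous fun p => klReal p q := by
  have := Real.binEntropy_continuous
  simp only [klReal_eq_neg_binEntropy_sub _ hq0 hq1]
  fun_prop

lemma hasDerivAt_klReal_right (p : ℝ) (hq0 : 0 < q) (hq1 : q < 1) :
    HasDerivAt (klReal p) ((q - p) / (q * (1 - q))) q := by
  have hq1' := sub_pos.2 hq1
  have heq : klReal p =ᶠ[nhds q]
      fun q => -Real.binEntropy p - p * Real.log q - (1 - p) * Real.log (1 - q) := by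
    filter_upwards [Ioo_mem_nhds hq0 hq1] with x hx
      using klReal_eq_neg_binEntropy_sub p hx.1 hx.2
  have hlog := (Real.hasDerivAt_log hq0.ne').const_mul p
  have hlog' := (((hasDerivAt_id' q).const_sub 1).log hq1'.ne').const_mul (1 - p)
  refine HasDerivAt.congr_of_eventuallyEq ?_ heq
  refine (((hasDerivAt_const q (-Real.binEntropy p)).sub hlog).sub hlog').congr_deriv ?_
  field_simp
  ring

lemma continuousAt_klReal_right (p : ℝ) (hq0 : 0 < q) (hq1 : q < 1) :
    ContinuousAt (klReal p) q :=
  (hasDerivAt_klReal_right p hq0 hq1).continuousAt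

lemma tendsto_klReal_one (hp0 : 0 ≤ p) (hp1 : p < 1) :
    Tendsto (klReal p) (nhdsWithin 1 (Set.Iio 1)) atTop := by
  have hsub : Tendsto (fun q : ℝ => 1 - q) (nhdsWithin 1 (Set.Iio 1))
      (nhdsWithin 0 (Set.Ioi 0)) := by
    refine tendsto_nhdsWithin_iff.2 ⟨?_, ?_⟩
    · exact ((continuous_sub_left (1 : ℝ)).tendsto' 1 0 (sub_self 1)).mono_left nhdsWithin_le_nhds
    · filter_upwards [self_mem_nhdsWithin] with q hq using sub_pos.2 (Set.mem_Iio.1 hq)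
  have hlog := Real.tendsto_log_nhdsGT_zero.comp hsub
  have hlower : Tendsto (fun q : ℝ => -Real.binEntropy p + (1 - p) * -Real.log (1 - q))
      (nhdsWithin 1 (Set.Iio 1)) atTop :=
    tendsto_atTop_add_const_left _ _
      ((tendsto_neg_atBot_atTop.comp hlog).const_mul_atTop (sub_pos.2 hp1))
  refine tendsto_atTop_mono' _ ?_ hlower
  filter_upwards [Ioo_mem_nhdsLT (zero_lt_one' ℝ)] with q hq
  rw [klReal_eq_neg_binEntropy_sub p hq.1 hq.2]
  linarith [mul_nonpos_of_nonneg_of_nonpos hp0 (Real.log_nonpos hq.1.le hq.2.le)]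

lemma bernKL_eq_ofReal_klReal (hq0 : 0 < q) (hq1 : q < 1) :
    bernKL p q = ENNReal.ofReal (klReal p q) := by
  rw [bernKL, if_neg, klReal]
  rintro (h | h)
  · exact hq1.not_ge h.2
  · exact hq0.ne' h.2

lemma bernKL_eq_top (hp1 : p < 1) (hq1 : 1 ≤ q) : bernKL p q = ∞ :=
  if_pos (Or.inl ⟨hp1, hq1⟩)

lemma exists_lt_klReal_right (hp0 : 0 ≤ p) (hpq : p < q) (hq1 : q ≤ 1)
    (hc : ENNReal.ofReal c < bernKL p q) : ∃ y, p < y ∧ y < q ∧ c < klReal p y := by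
  suffices h : ∀ᶠ y in nhdsWithin q (Set.Iio q), c < klReal p y by
    obtain ⟨y, hcy, hy⟩ := (h.and (Ioo_mem_nhdsLT hpq)).exists
    exact ⟨y, hy.1, hy.2, hcy⟩
  rcases hq1.eq_or_lt with rfl | hq1
  · exact (tendsto_klReal_one hp0 hpq).eventually_gt_atTop c
  · have hq0 := hp0.trans_lt hpq
    rw [bernKL_eq_ofReal_klReal hq0 hq1] at hc
    exact ((continuousAt_klReal_right p hq0 hq1).eventually_const_lt
      (ENNReal.ofReal_lt_ofReal_iff'.1 hc).1).filter_mono nhdsWithin_le_nhds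

lemma exists_lt_klReal {v : ℝ} (hp0 : 0 ≤ p) (hpq : p < q) (hq1 : q ≤ 1) (hpv : p < v)
    (hc : ENNReal.ofReal c < bernKL p q) :
    ∃ z y, p < z ∧ z < v ∧ z < y ∧ y < q ∧ c < klReal z y := by
  obtain ⟨y, hpy, hyq, hcy⟩ := exists_lt_klReal_right hp0 hpq hq1 hc
  have hcont := continuous_klReal_left (hp0.trans_lt hpy) (hyq.trans_le hq1)
  obtain ⟨z, hcz, hpz, hz⟩ := (((hcont.continuousAt.eventually_const_lt hcy).filter_mono
    nhdsWithin_le_nhds).and (Ioo_mem_nhdsGT (lt_min hpv hpy))).exists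
  exact ⟨z, y, hpz, hz.trans_le (min_le_left _ _), hz.trans_le (min_le_right _ _), hyq, hcz⟩

end KullbackLeibler

/-! ### Asymptotic and bounded regret -/

section Limsup

variable {ι α : Type*} {l : Filter α}

lemma limsup_add_le_ennreal (u v : α → ℝ≥0∞) :
    limsup (u + v) l ≤ limsup u l + limsup v l := by
  refine ENNReal.le_of_forall_pos_le_add fun η hη hlt => ?_
  have hη' : (η / 2 : ℝ≥0∞) ≠ 0 := by simpa using hη.ne'
  obtain ⟨hu, hv⟩ := ENNReal.add_lt_top.1 hlt
  refine limsup_le_of_le (by isBoundedDefault) ?_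
  filter_upwards [eventually_lt_of_limsup_lt (ENNReal.lt_add_right hu.ne hη'),
    eventually_lt_of_limsup_lt (ENNReal.lt_add_right hv.ne hη')] with x hux hvx
  calc u x + v x ≤ limsup u l + η / 2 + (limsup v l + η / 2) := add_le_add hux.le hvx.le
    _ = limsup u l + limsup v l + η := by rw [add_add_add_comm, ENNReal.add_halves]

lemma limsup_sum_le (s : Finset ι) (u : ι → α → ℝ≥0∞) :
    limsup (∑ i ∈ s, u i) l ≤ ∑ i ∈ s, limsup (u i) l := by
  classical
  induction s using Finset.induction_on with
  | empty => exact limsup_const_bot.le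
  | insert i s hi ih =>
    simp only [Finset.sum_insert hi]
    exact (limsup_add_le_ennreal _ _).trans (by gcongr)

lemma limsup_ofReal_div_le_inv {d : ℝ≥0∞} {u v : α → ℝ}
    (hv : ∀ᶠ x in l, 0 < v x)
    (h : ∀ c : ℝ, 0 < c → ENNReal.ofReal c < d → ∀ η > 0, ∀ᶠ x in l, u x ≤ (c⁻¹ + η) * v x) :
    limsup (fun x => ENNReal.ofReal (u x / v x)) l ≤ d⁻¹ := by
  rw [ENNReal.le_inv_iff_le_inv]
  refine le_of_forall_lt fun b hb => ?_
  obtain ⟨c, hbc, hc⟩ := exists_between hb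
  refine hbc.trans_le (ENNReal.le_inv_iff_le_inv.1 ?_)
  lift c to ℝ≥0 using hc.ne_top
  have hc0 : 0 < (c : ℝ) := NNReal.coe_pos.2 (ENNReal.coe_pos.1 (zero_le.trans_lt hbc))
  refine ENNReal.le_of_forall_pos_le_add fun η hη _ => limsup_le_of_le (by isBoundedDefault) ?_
  filter_upwards [hv, h c hc0 (by rwa [ENNReal.ofReal_coe_nnreal]) η hη] with x hvx hux
  calc ENNReal.ofReal (u x / v x) ≤ ENNReal.ofReal (c⁻¹ + η : ℝ≥0) :=
        ENNReal.ofReal_le_ofReal ((div_le_iff₀ hvx).2 hux)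
    _ = (c : ℝ≥0∞)⁻¹ + η := by
        rw [ENNReal.ofReal_coe_nnreal, ENNReal.coe_add, ENNReal.coe_inv (NNReal.coe_pos.1 hc0).ne']

end Limsup

namespace Bandit

variable {K : ℕ} (B : Bandit K) {ε : ℝ} {f : ℝ → ℝ} {a : Fin K}

lemma mean_add_lt_optMean (ha : ε < B.gap a) : B.mean a + ε < B.optMean := by
  unfold gap at ha
  linarith

lemma mean_lt_of_lt_gap (hε0 : 0 ≤ ε) (ha : ε < B.gap a) : B.mean a < B.optMean * (1 - ε) := by
  nlinarith [B.optMean_le_one, B.mean_add_lt_optMean ha]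

lemma eps_lt_one_of_lt_gap (ha : ε < B.gap a) : ε < 1 :=
  ha.trans_le (B.gap_le_one a)

variable [NeZero K]

lemma exists_expectedSum_play_le (hε0 : 0 ≤ ε) (hopt : 1 - ε < B.optMean) (ha : ε < B.gap a) :
    ∃ M, ∀ T, expectedSum (playLaw ε) B.means T (fun h => playProb (playLaw ε) h a) ≤ M := by
  obtain ⟨o, ho⟩ := B.exists_mean_eq_optMean
  have hmean := B.mean_lt_of_lt_gap hε0 ha
  rw [← ho] at hopt hmean
  exact LenientBandit.exists_expectedSum_play_le B.means hε0 (B.eps_lt_one_of_lt_gap ha) hopt hmean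

lemma eventually_expectedSum_play_le (hε0 : 0 ≤ ε) (ha : ε < B.gap a) {c : ℝ} (hc0 : 0 < c)
    (hc : ENNReal.ofReal c < bernKL (B.mean a / (1 - ε)) (B.optMean / (1 - ε)))
    (hopt : B.optMean ≤ 1 - ε) {η : ℝ} (hη : 0 < η) :
    ∀ᶠ T : ℕ in atTop, expectedSum (playLaw ε) B.means T (fun h => playProb (playLaw ε) h a)
      ≤ (c⁻¹ + η) * Real.log T := by
  obtain ⟨o, ho⟩ := B.exists_mean_eq_optMean
  have hε1 := B.eps_lt_one_of_lt_gap ha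
  have hr := sub_pos.2 hε1
  have hmean := B.mean_lt_of_lt_gap hε0 ha
  have hlt := B.mean_add_lt_optMean ha
  rw [← ho] at hc hopt hmean hlt
  obtain ⟨z, y, haz, hzo, hzy, hyo, hcz⟩ := exists_lt_klReal (div_nonneg (B.mean_nonneg a) hr.le)
    (div_lt_div_of_pos_right (by linarith) hr) ((div_le_one hr).2 hopt) ((div_lt_iff₀ hr).2 hmean)
    hc
  filter_upwards [LenientBandit.eventually_expectedSum_play_le (a := a) (o := o) (z := z * (1 - ε))
    (y := y * (1 - ε)) B.means hε0 hε1 hopt ((div_lt_iff₀ hr).1 haz)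
    (mul_lt_mul_of_pos_right hzo hr) (mul_lt_mul_of_pos_right hzy hr) ((lt_div_iff₀ hr).1 hyo) hη]
    with T hT
  rw [mul_div_cancel_right₀ _ hr.ne', mul_div_cancel_right₀ _ hr.ne', one_div] at hT
  refine hT.trans ?_
  have := Real.log_natCast_nonneg T
  gcongr

lemma limsup_expectedSum_play_div_log_le (hε0 : 0 ≤ ε) (ha : ε < B.gap a) :
    limsup (fun T : ℕ => ENNReal.ofReal (expectedSum (playLaw ε) B.means T
        (fun h => playProb (playLaw ε) h a) / Real.log T)) atTop
      ≤ (bernKL (B.mean a / (1 - ε)) (B.optMean / (1 - ε)))⁻¹ := by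
  have hlog : Tendsto (fun T : ℕ => Real.log (T : ℝ)) atTop atTop :=
    Real.tendsto_log_atTop.comp tendsto_natCast_atTop_atTop
  refine limsup_ofReal_div_le_inv (hlog.eventually_gt_atTop 0) fun c hc0 hc η hη => ?_
  rcases le_or_gt B.optMean (1 - ε) with hopt | hopt
  · exact B.eventually_expectedSum_play_le hε0 ha hc0 hc hopt hη
  · obtain ⟨M, hM⟩ := B.exists_expectedSum_play_le hε0 hopt ha
    filter_upwards [hlog.eventually_ge_atTop (M / (c⁻¹ + η))] with T hT
    exact (hM T).trans ((div_le_iff₀' (by positivity)).1 hT)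

open Classical in
lemma lenientRegret_eq_sum_filter (hf : IsGapFunction ε f) (T : ℕ) :
    B.lenientRegret ε f T = ∑ a with ε < B.gap a, f (B.gap a) *
      expectedSum (playLaw ε) B.means T (fun h => playProb (playLaw ε) h a) := by
  rw [B.lenientRegret_eq_sum ε (hf.gap_nonneg B), Finset.sum_filter_of_ne]
  intro a _ hne
  contrapose! hne
  rw [hf.eq_zero _ ⟨B.gap_nonneg a, hne⟩, zero_mul]

lemma limsup_lenientRegret_le (hf : IsGapFunction ε f) :
    limsup (fun T : ℕ => ENNReal.ofReal (B.lenientRegret ε f T / Real.log T)) atTop ≤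
      B.gapSum ε f (fun a => bernKL (B.mean a / (1 - ε)) (B.optMean / (1 - ε))) := by
  classical
  have hsum : (fun T : ℕ => ENNReal.ofReal (B.lenientRegret ε f T / Real.log T))
      = ∑ a with ε < B.gap a, fun T : ℕ => ENNReal.ofReal (f (B.gap a)) *
        ENNReal.ofReal (expectedSum (playLaw ε) B.means T (fun h => playProb (playLaw ε) h a)
          / Real.log T) := by
    funext T
    have hplay (a) : 0 ≤ expectedSum (playLaw ε) B.means T (fun h => playProb (playLaw ε) h a) :=
      expectedSum_nonneg _ _ T fun h => playProb_nonneg _ h a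
    rw [B.lenientRegret_eq_sum_filter hf, Finset.sum_div, Finset.sum_apply,
      ENNReal.ofReal_sum_of_nonneg fun a _ => div_nonneg
        (mul_nonneg (hf.gap_nonneg B a) (hplay a)) (Real.log_natCast_nonneg T)]
    simp only [mul_div_assoc, ENNReal.ofReal_mul (hf.gap_nonneg B _)]
  rw [hsum, gapSum]
  refine (limsup_sum_le _ _).trans (Finset.sum_le_sum fun a ha => ?_)
  rw [ENNReal.limsup_const_mul_of_ne_top ENNReal.ofReal_ne_top, div_eq_mul_inv]
  gcongr
  exact B.limsup_expectedSum_play_div_log_le hf.eps_mem.1 (Finset.mem_filter.1 ha).2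

end Bandit

/-- The expected number of plays of arm `a` in an infinite run of `ε`-TS on Bernoulli arms with
means `p`. It is `0` when that number is infinite, the supremum then being over an unbounded set. -/
def totalPlays {K : ℕ} [NeZero K] (ε : ℝ) (p : Fin K → unitInterval) (a : Fin K) : ℝ :=
  ⨆ T, expectedSum (playLaw ε) p T (fun h => playProb (playLaw ε) h a)

lemma totalPlays_nonneg {K : ℕ} [NeZero K] (ε : ℝ) (p : Fin K → unitInterval) (a : Fin K) :
    0 ≤ totalPlays ε p a :=
  Real.iSup_nonneg fun T => expectedSum_nonneg _ _ T fun h => playProb_nonneg _ h a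

lemma Bandit.lenientRegret_le_sum_totalPlays_mul {K : ℕ} [NeZero K] (B : Bandit K) {ε : ℝ}
    {f : ℝ → ℝ} (hf : IsGapFunction ε f) (hopt : 1 - ε < B.optMean) (T : ℕ) :
    B.lenientRegret ε f T ≤ (∑ a, totalPlays ε B.means a) * ⨆ a, f (B.gap a) := by
  classical
  have hsup (a) : f (B.gap a) ≤ ⨆ a, f (B.gap a) :=
    le_ciSup (Set.finite_range fun a => f (B.gap a)).bddAbove a
  have hsup0 : 0 ≤ ⨆ a, f (B.gap a) := Real.iSup_nonneg (hf.gap_nonneg B)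
  rw [B.lenientRegret_eq_sum_filter hf]
  calc ∑ a with ε < B.gap a, f (B.gap a) * expectedSum (playLaw ε) B.means T
        (fun h => playProb (playLaw ε) h a)
      ≤ ∑ a with ε < B.gap a, totalPlays ε B.means a * ⨆ a, f (B.gap a) := by
        refine Finset.sum_le_sum fun a ha => ?_
        obtain ⟨M, hM⟩ :=
          B.exists_expectedSum_play_le hf.eps_mem.1 hopt (Finset.mem_filter.1 ha).2
        rw [mul_comm]
        exact mul_le_mul (le_ciSup ⟨M, Set.forall_mem_range.2 hM⟩ T) (hsup a)
          (hf.gap_nonneg B a) (totalPlays_nonneg ε _ a)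
    _ ≤ ∑ a, totalPlays ε B.means a * ⨆ a, f (B.gap a) :=
        Finset.sum_le_sum_of_subset_of_nonneg (Finset.filter_subset _ _) fun a _ _ =>
          mul_nonneg (totalPlays_nonneg ε _ a) hsup0
    _ = (∑ a, totalPlays ε B.means a) * ⨆ a, f (B.gap a) := (Finset.sum_mul _ _ _).symm

/-! ### The order of magnitude of the bound -/

section KullbackLeiblerScaling

variable {p q r σ u : ℝ}

lemma klReal_self (p : ℝ) : klReal p p = 0 := by
  have mul_log_div_self : ∀ x : ℝ, x * Real.log (x / x) = 0 := fun x => by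
    rcases eq_or_ne x 0 with rfl | hx
    · simp
    · rw [div_self hx, Real.log_one, mul_zero]
  rw [klReal, mul_log_div_self, mul_log_div_self, add_zero]

lemma continuousOn_klReal_right (hp0 : 0 ≤ p) : ContinuousOn (klReal p) (Set.Ico p 1) := by
  rintro q ⟨hpq, hq1⟩
  refine ContinuousAt.continuousWithinAt ?_
  rcases (hp0.trans hpq).eq_or_lt with rfl | hq0
  · obtain rfl : p = 0 := le_antisymm hpq hp0
    have h : klReal 0 = fun q => Real.log (1 / (1 - q)) := by
      funext q
      simp [klReal]
    rw [h]
    fun_prop (disch := norm_num)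
  · exact continuousAt_klReal_right p hq0 hq1

lemma hasDerivAt_klReal_div_div (p : ℝ) (hr : 0 < r) (hu0 : 0 < u) (hur : u < r) :
    HasDerivAt (fun u => klReal (p / r) (u / r)) ((u - p) / (u * (r - u))) u := by
  have hur' := sub_pos.2 hur
  refine ((hasDerivAt_klReal_right (p / r) (div_pos hu0 hr) ((div_lt_one hr).2 hur)).comp u
    ((hasDerivAt_id' u).div_const r)).congr_deriv ?_
  rw [one_sub_div hr.ne']
  field_simp

lemma hasDerivAt_klReal_affine (p σ : ℝ) (h0 : 0 < p + σ * (u - p)) (h1 : p + σ * (u - p) < 1) :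
    HasDerivAt (fun u => klReal p (p + σ * (u - p)))
      (σ ^ 2 * (u - p) / ((p + σ * (u - p)) * (1 - (p + σ * (u - p))))) u := by
  refine ((hasDerivAt_klReal_right p h0 h1).comp u
    ((((hasDerivAt_id' u).sub_const p).const_mul σ).const_add p)).congr_deriv ?_
  ring

/-- The two sides agree at `q = p`, and the derivative in `q` of the left one is the smaller:
with `x = p + σ * (u - p)`, both are of the form `σ ^ 2 * (u - p) / _`, with denominators
`x * (1 - x)` and `u * (r - u)`. -/
lemma klReal_affine_le (hp0 : 0 ≤ p) (hpq : p < q) (hqr : q < r) (hσ : 1 ≤ σ)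
    (hσq : p + σ * (q - p) ≤ q + (1 - r)) :
    klReal p (p + σ * (q - p)) ≤ σ ^ 2 * klReal (p / r) (q / r) := by
  have hr : 0 < r := by linarith
  have hle : ∀ u ∈ Set.Icc p q, u ≤ p + σ * (u - p) ∧ p + σ * (u - p) ≤ u + (1 - r) := by
    intro u ⟨hpu, huq⟩
    constructor <;> nlinarith
  set G : ℝ → ℝ := fun u => σ ^ 2 * klReal (p / r) (u / r) - klReal p (p + σ * (u - p)) with hG
  have hcont : ContinuousOn G (Set.Icc p q) := by
    refine (continuousOn_const.mul ((continuousOn_klReal_right (div_nonneg hp0 hr.le)).comp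
      (by fun_prop) fun u hu => ?_)).sub
        ((continuousOn_klReal_right hp0).comp (by fun_prop) fun u hu => ?_)
    · exact ⟨div_le_div_of_nonneg_right hu.1 hr.le, (div_lt_one hr).2 (hu.2.trans_lt hqr)⟩
    · exact ⟨hu.1.trans (hle u hu).1, by linarith [hle u hu, hu.2]⟩
  have hderiv : ∀ u ∈ Set.Ioo p q, ∃ d ≥ 0, HasDerivAt G d u := by
    intro u hu
    obtain ⟨hle1, hle2⟩ := hle u (Set.Ioo_subset_Icc_self hu)
    have hu0 : 0 < u := hp0.trans_lt hu.1
    have hur : 0 < r - u := sub_pos.2 (hu.2.trans hqr)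
    refine ⟨_, ?_, ((hasDerivAt_klReal_div_div p hr hu0 (sub_pos.1 hur)).const_mul (σ ^ 2)).sub
      (hasDerivAt_klReal_affine p σ (by linarith) (by linarith))⟩
    rw [ge_iff_le, sub_nonneg, ← mul_div_assoc]
    exact div_le_div_of_nonneg_left (mul_nonneg (sq_nonneg σ) (sub_pos.2 hu.1).le)
      (mul_pos hu0 hur) (mul_le_mul hle1 (by linarith) hur.le (by linarith))
  choose! d hd0 hd using hderiv
  have hmono : MonotoneOn G (Set.Icc p q) := by
    refine monotoneOn_of_hasDerivWithinAt_nonneg (f' := d) (convex_Icc p q) hcont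
      (fun u hu => (hd u ?_).hasDerivWithinAt) fun u hu => hd0 u ?_ <;>
    simpa only [interior_Icc] using hu
  have hGpq := hmono (Set.left_mem_Icc.2 hpq.le) (Set.right_mem_Icc.2 hpq.le) hpq.le
  simpa only [hG, sub_self, mul_zero, add_zero, klReal_self, sub_nonneg] using hGpq

lemma klReal_add_le_four_mul {ε : ℝ} (hp0 : 0 ≤ p) (hε0 : 0 ≤ ε) (hpq : p + ε ≤ q) (hp : p < q)
    (hq : q < 1 - ε) :
    klReal p (q + ε) ≤ 4 * klReal (p / (1 - ε)) (q / (1 - ε)) := by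
  have hqp : 0 < q - p := sub_pos.2 hp
  have hr : 0 < 1 - ε := by linarith
  set σ := (q + ε - p) / (q - p)
  have hσ : p + σ * (q - p) = q + ε := by rw [div_mul_cancel₀ _ hqp.ne']; ring
  have hσ1 : 1 ≤ σ := (one_le_div hqp).2 (by linarith)
  have hσ2 : σ ≤ 2 := (div_le_iff₀ hqp).2 (by linarith)
  have hkl : 0 ≤ klReal (p / (1 - ε)) (q / (1 - ε)) :=
    klReal_nonneg (div_nonneg hp0 hr.le) ((div_le_one hr).2 (by linarith))
      (div_pos (by linarith) hr) ((div_lt_one hr).2 hq)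
  calc klReal p (q + ε) = klReal p (p + σ * (q - p)) := by rw [hσ]
    _ ≤ σ ^ 2 * klReal (p / (1 - ε)) (q / (1 - ε)) :=
        klReal_affine_le hp0 hp hq hσ1 (by linarith)
    _ ≤ 4 * klReal (p / (1 - ε)) (q / (1 - ε)) := by
        gcongr
        nlinarith

lemma bernKL_add_le_four_mul {ε : ℝ} (hp0 : 0 ≤ p) (hε0 : 0 ≤ ε) (hpq : p + ε < q) (hq1 : q ≤ 1) :
    bernKL p (q + ε) ≤ 4 * bernKL (p / (1 - ε)) (q / (1 - ε)) := by
  have hr : 0 < 1 - ε := by linarith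
  rcases lt_or_ge (q + ε) 1 with hlt | hge
  · have hqε : q < 1 - ε := by linarith
    rw [bernKL_eq_ofReal_klReal (by linarith) hlt,
      bernKL_eq_ofReal_klReal (div_pos (by linarith) hr) ((div_lt_one hr).2 hqε),
      ← ENNReal.ofReal_ofNat 4, ← ENNReal.ofReal_mul zero_le_four]
    exact ENNReal.ofReal_le_ofReal (klReal_add_le_four_mul hp0 hε0 hpq.le (by linarith) hqε)
  · rw [bernKL_eq_top ((div_lt_one hr).2 (by linarith)) ((one_le_div hr).2 (by linarith)),
      ENNReal.mul_top four_ne_zero]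
    exact le_top

end KullbackLeiblerScaling

section BernoulliMeasure

variable {X : Type*} [MeasurableSpace X] [MeasurableSingletonClass X] {x y : X}
  {p q : unitInterval}

lemma lintegral_bernoulliMeasure (x y : X) (p : unitInterval) (g : X → ℝ≥0∞) :
    ∫⁻ z, g z ∂bernoulliMeasure x y p
      = ENNReal.ofReal p * g x + ENNReal.ofReal (1 - p) * g y := by
  rw [bernoulliMeasure_def, lintegral_add_measure, lintegral_smul_measure, lintegral_smul_measure,
    lintegral_dirac, lintegral_dirac, ← unitInterval.coe_symm_eq]
  simp only [ENNReal.smul_def, smul_eq_mul, ← unitInterval.coe_toNNReal,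
    ENNReal.ofReal_coe_nnreal]

lemma bernoulliMeasure_eq_withDensity (hq0 : 0 < (q : ℝ)) (hq1 : (q : ℝ) < 1) {g : X → ℝ≥0∞}
    (hx : g x = ENNReal.ofReal (p / q)) (hy : g y = ENNReal.ofReal ((1 - p) / (1 - q))) :
    bernoulliMeasure x y p = (bernoulliMeasure x y q).withDensity g := by
  ext s hs
  have hq1' : 0 < 1 - (q : ℝ) := sub_pos.2 hq1
  rw [withDensity_apply _ hs, ← lintegral_indicator hs, ← lintegral_indicator_one hs,
    lintegral_bernoulliMeasure, lintegral_bernoulliMeasure]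
  have hind (z : X) : s.indicator g z = g z * s.indicator 1 z := by
    by_cases hz : z ∈ s <;> simp [hz]
  rw [hind, hind, hx, hy, ← mul_assoc, ← mul_assoc, ← ENNReal.ofReal_mul hq0.le,
    ← ENNReal.ofReal_mul hq1'.le, mul_div_cancel₀ _ hq0.ne', mul_div_cancel₀ _ hq1'.ne']

lemma klDiv_bernoulliMeasure (hxy : x ≠ y) (hq0 : 0 < (q : ℝ)) (hq1 : (q : ℝ) < 1) :
    klDiv (bernoulliMeasure x y p) (bernoulliMeasure x y q) = ENNReal.ofReal (klReal p q) := by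
  classical
  have hq1' : 0 < 1 - (q : ℝ) := sub_pos.2 hq1
  have hpq : 0 ≤ (p : ℝ) / q := div_nonneg p.2.1 hq0.le
  have hpq' : 0 ≤ (1 - p : ℝ) / (1 - q) := div_nonneg (sub_nonneg.2 p.2.2) hq1'.le
  set g : X → ℝ≥0∞ := fun z => if z = x then ENNReal.ofReal (p / q)
    else ENNReal.ofReal ((1 - p) / (1 - q))
  have hgm : Measurable g :=
    Measurable.ite (measurableSet_singleton x) measurable_const measurable_const
  have hgx : g x = ENNReal.ofReal (p / q) := if_pos rfl
  have hgy : g y = ENNReal.ofReal ((1 - p) / (1 - q)) := if_neg hxy.symm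
  have hd := bernoulliMeasure_eq_withDensity hq0 hq1 hgx hgy
  have hrn : (bernoulliMeasure x y p).rnDeriv (bernoulliMeasure x y q)
      =ᵐ[bernoulliMeasure x y q] g := hd ▸ Measure.rnDeriv_withDensity _ hgm
  rw [klDiv_eq_lintegral_klFun_of_ac (hd ▸ withDensity_absolutelyContinuous _ _),
    lintegral_congr_ae (hrn.mono fun z hz => by rw [hz]), lintegral_bernoulliMeasure, hgx, hgy,
    ENNReal.toReal_ofReal hpq, ENNReal.toReal_ofReal hpq', ← ENNReal.ofReal_mul hq0.le,
    ← ENNReal.ofReal_mul hq1'.le, ← ENNReal.ofReal_add (mul_nonneg hq0.le (klFun_nonneg hpq))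
      (mul_nonneg hq1'.le (klFun_nonneg hpq')), klReal_eq_klFun hq0.ne' hq1.ne]

lemma kInf_bernoulliMeasure_le {D : Set (Measure ℝ)}
    (hD : ∀ p : unitInterval, bernoulliMeasure (1 : ℝ) 0 p ∈ D) (hp1 : (p : ℝ) < 1) {x : ℝ}
    (hx0 : 0 < x) :
    kInf (bernoulliMeasure (1 : ℝ) 0 p) x D ≤ bernKL p x := by
  rcases lt_or_ge x 1 with hx1 | hx1
  swap
  · exact bernKL_eq_top hp1 hx1 ▸ le_top
  rw [bernKL_eq_ofReal_klReal hx0 hx1]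
  refine ge_of_tendsto (ENNReal.tendsto_ofReal
    ((continuousAt_klReal_right p hx0 hx1).mono_left (nhdsWithin_le_nhds (s := Set.Ioi x)))) ?_
  filter_upwards [Ioo_mem_nhdsGT hx1] with q ⟨hxq, hq1⟩
  have hq0 := hx0.trans hxq
  rw [← klDiv_bernoulliMeasure (q := ⟨q, hq0.le, hq1.le⟩) (one_ne_zero (α := ℝ)) hq0 hq1, kInf]
  refine iInf₂_le_of_le _ (hD _) (iInf_le_of_le ?_ le_rfl)
  simpa [integral_bernoulliMeasure] using hxq

end BernoulliMeasure

namespace Bandit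

variable {K : ℕ} (B : Bandit K) {ε : ℝ} (f : ℝ → ℝ)

lemma gapSum_le_mul_gapSum {c : ℝ≥0∞} (hc0 : c ≠ 0) (hc : c ≠ ∞) {d e : Fin K → ℝ≥0∞}
    (h : ∀ a, ε < B.gap a → e a ≤ c * d a) :
    B.gapSum ε f d ≤ c * B.gapSum ε f e := by
  rw [gapSum, gapSum, Finset.mul_sum]
  refine Finset.sum_le_sum fun a ha => ?_
  have hinv : c⁻¹ * (d a)⁻¹ ≤ (e a)⁻¹ := by
    rw [← ENNReal.mul_inv (Or.inl hc0) (Or.inl hc), ENNReal.inv_le_inv]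
    exact h a (Finset.mem_filter_univ a |>.1 ha)
  rw [div_eq_mul_inv, div_eq_mul_inv, mul_left_comm]
  gcongr
  exact (ENNReal.inv_mul_le_iff hc0 hc).1 hinv

lemma bernKL_mean_add_le_four_mul (hε0 : 0 ≤ ε) {a : Fin K} (ha : ε < B.gap a) :
    bernKL (B.mean a) (B.optMean + ε)
      ≤ 4 * bernKL (B.mean a / (1 - ε)) (B.optMean / (1 - ε)) :=
  bernKL_add_le_four_mul (B.mean_nonneg a) hε0 (B.mean_add_lt_optMean ha) B.optMean_le_one

lemma gapSum_bernKL_div_le (hε0 : 0 ≤ ε) :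
    B.gapSum ε f (fun a => bernKL (B.mean a / (1 - ε)) (B.optMean / (1 - ε)))
      ≤ 4 * B.gapSum ε f (fun a => bernKL (B.mean a) (B.optMean + ε)) :=
  B.gapSum_le_mul_gapSum f four_ne_zero ENNReal.ofNat_ne_top fun _ ha =>
    B.bernKL_mean_add_le_four_mul hε0 ha

lemma gapSum_bernKL_div_le_kInf (hε0 : 0 ≤ ε) {D : Set (Measure ℝ)}
    (hD : ∀ p : unitInterval, bernoulliMeasure (1 : ℝ) 0 p ∈ D)
    (hB : ∀ a, ∃ p : unitInterval, B.law a = bernoulliMeasure (1 : ℝ) 0 p) :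
    B.gapSum ε f (fun a => bernKL (B.mean a / (1 - ε)) (B.optMean / (1 - ε)))
      ≤ 4 * B.gapSum ε f (fun a => kInf (B.law a) (B.optMean + ε) D) := by
  refine B.gapSum_le_mul_gapSum f four_ne_zero ENNReal.ofNat_ne_top fun a ha => ?_
  have hlt := B.mean_add_lt_optMean ha
  have h0 := B.mean_nonneg a
  have h1 : B.mean a < 1 := by linarith [B.optMean_le_one]
  obtain ⟨p, hp⟩ := hB a
  have hmean : B.mean a = p := by simp [mean, hp, integral_bernoulliMeasure]
  refine le_trans ?_ (B.bernKL_mean_add_le_four_mul hε0 ha)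
  rw [hp, hmean]
  exact kInf_bernoulliMeasure_le hD (hmean ▸ h1) (by linarith)

end Bandit

end LenientBandit

end

theorem mainTheorem1 :
    -- the asymptotic upper bound
    (∀ (K : ℕ) [NeZero K] (B : LenientBandit.Bandit K) (ε : ℝ) (f : ℝ → ℝ),
      LenientBandit.IsGapFunction ε f →
      limsup (fun T : ℕ => ENNReal.ofReal (B.lenientRegret ε f T / Real.log T)) atTop ≤
        B.gapSum ε f (fun a =>
          LenientBandit.bernKL (B.mean a / (1 - ε)) (B.optMean / (1 - ε)))) ∧
    -- its order of magnitude, with an absolute constant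
    (∃ C : ℝ≥0, ∀ (K : ℕ) [NeZero K] (B : LenientBandit.Bandit K) (ε : ℝ) (f : ℝ → ℝ),
      LenientBandit.IsGapFunction ε f →
      B.gapSum ε f (fun a =>
          LenientBandit.bernKL (B.mean a / (1 - ε)) (B.optMean / (1 - ε))) ≤
        C * B.gapSum ε f (fun a => LenientBandit.bernKL (B.mean a) (B.optMean + ε)) ∧
      -- for Bernoulli arms, this is the lower bound in terms of `kInf`
      ∀ D : Set (Measure ℝ), (∀ ν ∈ D, LenientBandit.IsUnitLaw ν) →
        (∀ p : unitInterval, bernoulliMeasure (1 : ℝ) 0 p ∈ D) →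
        (∀ a, ∃ p : unitInterval, B.law a = bernoulliMeasure (1 : ℝ) 0 p) →
        B.gapSum ε f (fun a =>
            LenientBandit.bernKL (B.mean a / (1 - ε)) (B.optMean / (1 - ε))) ≤
          C * B.gapSum ε f (fun a => LenientBandit.kInf (B.law a) (B.optMean + ε) D)) ∧
    -- bounded regret if the optimal mean exceeds `1 - ε`; the constant depends only on
    -- `ε` and the means of the arms
    (∀ (K : ℕ) [NeZero K] (ε : ℝ) (m : Fin K → ℝ), ∃ M : ℝ,
      ∀ (B : LenientBandit.Bandit K) (f : ℝ → ℝ), (∀ a, B.mean a = m a) →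
        LenientBandit.IsGapFunction ε f → 1 - ε < B.optMean →
        ∀ T : ℕ, B.lenientRegret ε f T ≤ M * ⨆ a, f (B.gap a)) := by
  refine ⟨fun K _ B ε f hf => B.limsup_lenientRegret_le hf,
    ⟨4, fun K _ B ε f hf => ⟨B.gapSum_bernKL_div_le f hf.eps_mem.1,
      fun D _ hD hB => B.gapSum_bernKL_div_le_kInf f hf.eps_mem.1 hD hB⟩⟩,
    fun K _ ε m => ?_⟩
  set p : Fin K → unitInterval := fun a => Set.projIcc 0 1 zero_le_one (m a)
  refine ⟨∑ a, LenientBandit.totalPlays ε p a, fun B f hB hf hopt T => ?_⟩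
  have hp : B.means = p := funext fun a => by
    rw [← Set.projIcc_val zero_le_one (B.means a)]
    exact congrArg _ (hB a)
  exact hp ▸ B.lenientRegret_le_sum_totalPlays_mul hf hopt T
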